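/- Let $M$ be a smooth $n$-manifold and let $Y\to Y_0\to M$ be a graded bundle: $Y_0\to M$ is a smooth fibred manifold (e.g. an affine bundle) and $Y\to Y_0$ is a graded vector bundle of finite rank whose fibre coordinates have nonzero ghost numbers. Let $\Omega_{loc}^{p,q,r}$ be the space of local forms (forms on the infinite jet bundle $J^\infty Y$, polynomial in the jet coordinates of nonzero ghost number) of horizontal degree $p$, vertical degree $q$ and ghost number $r$, with graded commutativity sign $(-1)^{ii'+(j+k)(j'+k')}$ for tridegrees $(i,j,k)$, $(i',j',k')$, horizontal differential $d_h$ and vertical differential $d_v$. For a vertical local vector field $\Xi$ of ghost number $k$ put $\mathrm{Lie}_\Xi=\iota_\Xi d_v+(-1)^k d_v\iota_\Xi$. Write $\alpha\simeq\beta$ if $\alpha-\beta=d_h\kappa$ for some local form $\kappa$. Let $0\le m\le n$. An $m$-extended BV-BFV Lagrangian field theory consists of a vertical local vector field $Q$ of ghost number $1$ with $Q^2=0$ and local forms $$\mathcal L^{(p)}\in\Omega_{loc}^{n-p,0,p},\qquad \gamma^{(p)}\in\Omega_{loc}^{n-p,1,p-1},\qquad \omega^{(p)}\in\Omega_{loc}^{n-p,2,p-1}\qquad(0\le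 p\le n)$$ such that 1. $\mathcal L^{(0)}$ has compact support along $M$ and $\mathrm{Lie}_Q\mathcal L^{(0)}\simeq 0$; 2. $\omega^{(0)}$ is a BV symplectic local form: $d_v\omega^{(0)}\simeq0$, $\omega^{(0)}$ is invariant under the interior Euler operator, and $\iota_\Xi\omega^{(0)}\simeq 0$ implies $\Xi=0$ for every vertical local vector field $\Xi$; 3. $\mathrm{Lie}_Q\omega^{(p)}+d_h\omega^{(p+1)}=0$ for $0\le p<n$ and $\mathrm{Lie}_Q\omega^{(n)}=0$; 4. $\omega^{(p)}=d_v\gamma^{(p)}$ for $p\le m$, and $\omega^{(p)}=0$ for $p>m$; 5. $\iota_Q\omega^{(p)}=d_v\mathcal L^{(p)}+d_h\gamma^{(p+1)}$ for $0\le p<n$, and $\iota_Q\omega^{(n)}=d_v\mathcal L^{(n)}$. Put $\mathcal L^{(n+1)}=0$, $\gamma^{(n+1)}=0$, and let $\mathcal L_{CMR}^{(p)}=2\mathcal L^{(p)}-\iota_Q\gamma^{(p)}$ be the modified Lagrangian. Proposition. In every $m$-extended BV-BFV Lagrangian field theory, for all $0\le p\le n$, $$\mathrm{Lie}_Q\mathcal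 L^{(p)}=d_h\bigl(\mathcal L_{CMR}^{(p+1)}\bigr).$$ In particular $\mathrm{Lie}_Q\mathcal L^{(p)}\simeq 0$, i.e. $Q$ is a symmetry of every $\mathcal L^{(p)}$. -/

import Mathlib

open scoped TensorProduct Manifold ContDiff

/-!
# The variational bicomplex of a graded bundle and extended BV-BFV theories

Part 1 builds, for `n` base coordinates `x^μ`, `d` fibre coordinates `u^a` of ghost number `0`, and
fibre coordinates `u^j` (`j : J`) of ghost numbers `deg j`, the algebra of local forms of one adapted
coordinate chart, with its differentials and contractions.  Part 2 defines graded bundles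
`Y → Y₀ → M` over a manifold, their adapted charts, and global local forms and vertical local vector
fields as families of coordinate expressions that match under all changes of adapted charts.
Part 3 defines extended BV-BFV Lagrangian field theories.
-/

universe u v w

namespace BVBFV

noncomputable section

/-! ### Part 1: local forms in one chart -/

section LocalAlgebra

/-- Multi-indices of partial derivatives in `n` variables; `μ ::ₘ I` is `I ∪ {μ}`. -/
abbrev MIdx (n : ℕ) : Type := Multiset (Fin n)

/-- Coordinates of ghost number zero on the infinite jet space: `x^μ` and `u^a_I`. -/
abbrev Coord (n d : ℕ) : Type := Fin n ⊕ (Fin d × MIdx n)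

/-- Points of the infinite jet space (of the degree zero part) in a chart. -/
abbrev Jet (n d : ℕ) : Type := Coord n d → ℝ

/-- A smooth function on the infinite jet space depending on finitely many coordinates only. -/
def IsLocalFun {n d : ℕ} (f : Jet n d → ℝ) : Prop :=
  ∃ (S : Finset (Coord n d)) (g : (S → ℝ) → ℝ), ContDiff ℝ ∞ g ∧ ∀ z, f z = g (fun s => z s)

theorem IsLocalFun.enlarge {n d : ℕ} {f : Jet n d → ℝ} {S T : Finset (Coord n d)} (hST : S ⊆ T)
    {g : (S → ℝ) → ℝ} (hg : ContDiff ℝ ∞ g) (h : ∀ z, f z = g (fun s => z s)) :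
    ∃ g' : (T → ℝ) → ℝ, ContDiff ℝ ∞ g' ∧ ∀ z, f z = g' (fun s => z s) :=
  ⟨fun y => g (fun s => y ⟨s.1, hST s.2⟩), hg.comp (by fun_prop), fun z => h z⟩

theorem IsLocalFun.common {n d : ℕ} {f g : Jet n d → ℝ} (hf : IsLocalFun f) (hg : IsLocalFun g) :
    ∃ (S : Finset (Coord n d)) (f' g' : (S → ℝ) → ℝ), ContDiff ℝ ∞ f' ∧ ContDiff ℝ ∞ g' ∧
      (∀ z, f z = f' (fun s => z s)) ∧ ∀ z, g z = g' (fun s => z s) := by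
  classical
  obtain ⟨S, f₁, hf₁, hf₂⟩ := hf
  obtain ⟨T, g₁, hg₁, hg₂⟩ := hg
  obtain ⟨f', h1, h2⟩ := IsLocalFun.enlarge (Finset.subset_union_left (s₂ := T)) hf₁ hf₂
  obtain ⟨g', h3, h4⟩ := IsLocalFun.enlarge (Finset.subset_union_right (s₁ := S)) hg₁ hg₂
  exact ⟨S ∪ T, f', g', h1, h3, h2, h4⟩

/-- The algebra of local functions of ghost number zero built from `x^μ` and `u^a_I`. -/
def LocFun (n d : ℕ) : Subalgebra ℝ (Jet n d → ℝ) where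
  carrier := {f | IsLocalFun f}
  mul_mem' := by
    intro f g hf hg
    obtain ⟨S, f', g', h1, h2, h3, h4⟩ := IsLocalFun.common hf hg
    exact ⟨S, fun y => f' y * g' y, h1.mul h2, fun z => by simp [h3, h4]⟩
  add_mem' := by
    intro f g hf hg
    obtain ⟨S, f', g', h1, h2, h3, h4⟩ := IsLocalFun.common hf hg
    exact ⟨S, fun y => f' y + g' y, h1.add h2, fun z => by simp [h3, h4]⟩
  algebraMap_mem' := fun r => ⟨∅, fun _ => r, contDiff_const, fun z => by simp⟩

/-- Partial derivative of a function on the infinite jet space. -/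
def pderivRaw {n d : ℕ} (a : Coord n d) (f : Jet n d → ℝ) (z : Jet n d) : ℝ :=
  deriv (fun t => f (Function.update z a t)) (z a)

theorem pderivRaw_hasDerivAt {n d : ℕ} {S : Finset (Coord n d)} {g : (S → ℝ) → ℝ}
    (hg : ContDiff ℝ ∞ g) (a : Coord n d) (z : Jet n d) :
    HasDerivAt (fun t => g (fun s => Function.update z a t s))
      (fderiv ℝ g (fun s => z s) (fun s => if (s : Coord n d) = a then 1 else 0)) (z a) := by
  have h1 : HasDerivAt (fun t => (fun s : S => Function.update z a t s))
      (fun s : S => if (s : Coord n d) = a then (1 : ℝ) else 0) (z a) := by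
    rw [hasDerivAt_pi]
    intro s
    by_cases hs : (s : Coord n d) = a
    · subst hs
      simpa using hasDerivAt_id' (z s)
    · simpa [Function.update_of_ne hs, hs] using hasDerivAt_const (z a) (z s)
  have h2 : HasFDerivAt g (fderiv ℝ g (fun s => z s))
      ((fun t => (fun s : S => Function.update z a t s)) (z a)) := by
    simpa using (hg.differentiable (by simp)).differentiableAt.hasFDerivAt (x := fun s : S => z s)
  exact h2.comp_hasDerivAt (z a) h1

theorem IsLocalFun.hasDerivAt {n d : ℕ} {f : Jet n d → ℝ} (hf : IsLocalFun f) (a : Coord n d)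
    (z : Jet n d) :
    HasDerivAt (fun t => f (Function.update z a t)) (pderivRaw a f z) (z a) := by
  obtain ⟨S, g, hg, h⟩ := hf
  have := pderivRaw_hasDerivAt hg a z
  simp only [pderivRaw, h]
  exact this.differentiableAt.hasDerivAt

theorem IsLocalFun.pderivRaw {n d : ℕ} {f : Jet n d → ℝ} (hf : IsLocalFun f) (a : Coord n d) :
    IsLocalFun (pderivRaw a f) := by
  obtain ⟨S, g, hg, h⟩ := hf
  refine ⟨S, fun y => fderiv ℝ g y (fun s => if (s : Coord n d) = a then 1 else 0), ?_, ?_⟩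
  · exact (hg.fderiv_right (m := ∞) (by simp)).clm_apply contDiff_const
  · intro z
    simp only [BVBFV.pderivRaw, h]
    exact (pderivRaw_hasDerivAt hg a z).deriv

/-- Partial derivative on local functions. -/
def pderivFun {n d : ℕ} (a : Coord n d) : LocFun n d →ₗ[ℝ] LocFun n d where
  toFun f := ⟨pderivRaw a f.1, IsLocalFun.pderivRaw f.2 a⟩
  map_add' f g := by
    ext z
    exact ((IsLocalFun.hasDerivAt f.2 a z).add (IsLocalFun.hasDerivAt g.2 a z)).deriv
  map_smul' c f := by
    ext z
    exact ((IsLocalFun.hasDerivAt f.2 a z).const_mul c).deriv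

/-- The coordinate functions `x^μ`, `u^a_I`. -/
def coordFun {n d : ℕ} (a : Coord n d) : LocFun n d :=
  ⟨fun z => z a, {a}, fun y => y ⟨a, by simp⟩, by fun_prop, fun _ => rfl⟩

variable (n d : ℕ) {J : Type} (deg : J → ℤ)

/-- The remaining vertical generators: `inl (j, I)` is the coordinate `u^j_I` of nonzero ghost
number, and `inr (j, I)` is the vertical one-form `δu^j_I`, for every fibre coordinate. -/
abbrev VGen (n d : ℕ) (J : Type) : Type := (J × MIdx n) ⊕ ((Fin d ⊕ J) × MIdx n)

variable {d} in
/-- Ghost number of a fibre coordinate. -/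
def ghostCoord : Fin d ⊕ J → ℤ := Sum.elim (fun _ => 0) deg

variable {n d} in
/-- Ghost number of a vertical generator. -/
def ghost : VGen n d J → ℤ := Sum.elim (fun k => deg k.1) (fun k => ghostCoord deg k.1)

variable {n d} in
/-- Vertical form degree of a vertical generator. -/
def vdeg : VGen n d J → ℕ := Sum.elim (fun _ => 0) (fun _ => 1)

variable {n d} in
/-- A generator is even if vertical form degree plus ghost number is even. -/
def EvenGen (g : VGen n d J) : Prop := Even ((vdeg g : ℤ) + ghost deg g)

/-- The free graded commutative algebra on the vertical generators: even generators commute with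
everything, odd generators anticommute with each other. -/
abbrev VertAlg : Type :=
  MvPolynomial {g : VGen n d J // EvenGen deg g} ℝ ⊗[ℝ]
    ExteriorAlgebra ℝ ({g : VGen n d J // ¬ EvenGen deg g} →₀ ℝ)

/-- The algebra generated over `ℝ` by the `dx^μ` and the vertical generators.  The `dx^μ`
anticommute with each other and commute with all vertical generators, as required by the sign
rule `(-1)^{i i' + (j + k) (j' + k')}` for tridegrees `(i, j, k)` and `(i', j', k')`. -/
abbrev FormAlg : Type := ExteriorAlgebra ℝ (Fin n →₀ ℝ) ⊗[ℝ] VertAlg n d deg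

/-- The algebra of local forms in one chart: finite sums of local functions of ghost number zero
times products of the generators `u^j_I`, `dx^μ`, `δu^j_I`. -/
abbrev LocAlg : Type := LocFun n d ⊗[ℝ] FormAlg n d deg

instance : Ring (VertAlg n d deg) := Algebra.TensorProduct.instRing
instance : Algebra ℝ (VertAlg n d deg) := Algebra.TensorProduct.leftAlgebra
instance : Ring (FormAlg n d deg) := Algebra.TensorProduct.instRing
instance : Algebra ℝ (FormAlg n d deg) := Algebra.TensorProduct.leftAlgebra
instance : Ring (LocAlg n d deg) := Algebra.TensorProduct.instRing
instance : Algebra ℝ (LocAlg n d deg) := Algebra.TensorProduct.leftAlgebra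

variable {n d}

open Classical in
/-- A generator as an element of the vertical algebra. -/
def vgen (g : VGen n d J) : VertAlg n d deg :=
  if h : EvenGen deg g then MvPolynomial.X ⟨g, h⟩ ⊗ₜ 1
  else 1 ⊗ₜ ExteriorAlgebra.ι ℝ (Finsupp.single ⟨g, h⟩ 1)

open Classical in
/-- The left graded partial derivative with respect to a generator. -/
def vpderiv (g : VGen n d J) : VertAlg n d deg →ₗ[ℝ] VertAlg n d deg :=
  if h : EvenGen deg g then
    TensorProduct.map (MvPolynomial.pderiv (R := ℝ)
      (⟨g, h⟩ : {g : VGen n d J // EvenGen deg g})).toLinearMap LinearMap.id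
  else
    TensorProduct.map LinearMap.id
      (CliffordAlgebra.contractLeft
        (Finsupp.lapply (⟨g, h⟩ : {g : VGen n d J // ¬ EvenGen deg g})))

/-- `dx^μ` in `FormAlg`. -/
def fdx (μ : Fin n) : FormAlg n d deg := ExteriorAlgebra.ι ℝ (Finsupp.single μ 1) ⊗ₜ 1

/-- A vertical generator in `FormAlg`. -/
def fgen (g : VGen n d J) : FormAlg n d deg := 1 ⊗ₜ vgen deg g

/-- A local function of ghost number zero as a local form. -/
def lfun (f : LocFun n d) : LocAlg n d deg := f ⊗ₜ 1

/-- `dx^μ` as a local form. -/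
def ldx (μ : Fin n) : LocAlg n d deg := 1 ⊗ₜ fdx deg μ

/-- A vertical generator as a local form. -/
def lgen (g : VGen n d J) : LocAlg n d deg := 1 ⊗ₜ fgen deg g

/-- The jet coordinate `u^j_I`, of any ghost number, as a local form. -/
def lu : (Fin d ⊕ J) × MIdx n → LocAlg n d deg
  | (Sum.inl a, I) => lfun deg (coordFun (Sum.inr (a, I)))
  | (Sum.inr j, I) => lgen deg (Sum.inl (j, I))

/-- The vertical one-form `δu^j_I`. -/
def ldu (k : (Fin d ⊕ J) × MIdx n) : LocAlg n d deg := lgen deg (Sum.inr k)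

/-- Local forms of horizontal form degree `p`, vertical form degree `q` and ghost number `r`. -/
def homog (p q : ℕ) (r : ℤ) : Submodule ℝ (LocAlg n d deg) :=
  Submodule.span ℝ {b | ∃ (f : LocFun n d) (μs : List (Fin n)) (gs : List (VGen n d J)),
    μs.length = p ∧ (gs.map vdeg).sum = q ∧ (gs.map (ghost deg)).sum = r ∧
    b = lfun deg f * (μs.map fun μ => (ldx deg μ : LocAlg n d deg)).prod *
      (gs.map (lgen deg)).prod}

/-- The value of a local form at a point of the infinite jet space. -/
def evalAt (z : Jet n d) : LocAlg n d deg →ₐ[ℝ] FormAlg n d deg :=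
  (Algebra.TensorProduct.lid ℝ (FormAlg n d deg)).toAlgHom.comp
    (Algebra.TensorProduct.map ((Pi.evalAlgHom ℝ (fun _ : Jet n d => ℝ) z).comp (LocFun n d).val)
      (AlgHom.id ℝ (FormAlg n d deg)))

/-- `∂/∂x^μ` or `∂/∂u^a_I` acting on the function coefficients. -/
def coeffDeriv (a : Coord n d) : LocAlg n d deg →ₗ[ℝ] LocAlg n d deg :=
  TensorProduct.map (pderivFun a) LinearMap.id

/-- The left derivative with respect to a vertical generator. -/
def genDeriv (g : VGen n d J) : LocAlg n d deg →ₗ[ℝ] LocAlg n d deg :=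
  TensorProduct.map LinearMap.id (TensorProduct.map LinearMap.id (vpderiv deg g))

/-- The left derivative `∂/∂u^j_I`. -/
def uDeriv : (Fin d ⊕ J) × MIdx n → LocAlg n d deg →ₗ[ℝ] LocAlg n d deg
  | (Sum.inl a, I) => coeffDeriv deg (Sum.inr (a, I))
  | (Sum.inr j, I) => genDeriv deg (Sum.inl (j, I))

/-- The left derivative `∂/∂(δu^j_I)`, i.e. the contraction with `∂/∂u^j_I`. -/
def duDeriv (k : (Fin d ⊕ J) × MIdx n) : LocAlg n d deg →ₗ[ℝ] LocAlg n d deg :=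
  genDeriv deg (Sum.inr k)

/-- The total derivative in the direction `x^μ`,
`∂_μ + ∑ u^j_{I ∪ {μ}} ∂/∂u^j_I + ∑ δu^j_{I ∪ {μ}} ∂/∂(δu^j_I)`. -/
def totalDeriv (μ : Fin n) (b : LocAlg n d deg) : LocAlg n d deg :=
  coeffDeriv deg (Sum.inl μ) b
    + ∑ᶠ k : (Fin d ⊕ J) × MIdx n, lu deg (k.1, μ ::ₘ k.2) * uDeriv deg k b
    + ∑ᶠ k : (Fin d ⊕ J) × MIdx n, ldu deg (k.1, μ ::ₘ k.2) * duDeriv deg k b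

/-- The iterated total derivative for a multi-index. -/
def totalDerivs (I : MIdx n) (b : LocAlg n d deg) : LocAlg n d deg :=
  I.sort.foldr (totalDeriv deg) b

/-- The horizontal differential `d_h = ∑ dx^μ ∧ D_μ`. -/
def dhLoc (b : LocAlg n d deg) : LocAlg n d deg := ∑ μ : Fin n, ldx deg μ * totalDeriv deg μ b

/-- The vertical differential `d_v = ∑ δu^j_I ∧ ∂/∂u^j_I`. -/
def dvLoc (b : LocAlg n d deg) : LocAlg n d deg :=
  ∑ᶠ k : (Fin d ⊕ J) × MIdx n, ldu deg k * uDeriv deg k b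

/-- Contraction with the vertical local vector field
`∑ D_I(Ξ^j) ∂/∂u^j_I` with components `Ξ^j`. -/
def iotaLoc (Ξ : Fin d ⊕ J → LocAlg n d deg) (b : LocAlg n d deg) : LocAlg n d deg :=
  ∑ᶠ k : (Fin d ⊕ J) × MIdx n, totalDerivs deg k.2 (Ξ k.1) * duDeriv deg k b

/-- Lie derivative along a vertical local vector field of ghost number `k`:
`ι d_v + (-1)^k d_v ι`. -/
def lieLoc (k : ℤ) (Ξ : Fin d ⊕ J → LocAlg n d deg) (b : LocAlg n d deg) : LocAlg n d deg :=
  iotaLoc deg Ξ (dvLoc deg b) + ((-1 : ℝ) ^ k) • dvLoc deg (iotaLoc deg Ξ b)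

/-- The interior Euler operator on forms of vertical degree `s`:
`(1/s) ∑ δu^j ∧ (-D)_I (ι_{∂/∂u^j_I} b)`. -/
def interiorEulerLoc (s : ℕ) (b : LocAlg n d deg) : LocAlg n d deg :=
  ((s : ℝ)⁻¹) • ∑ᶠ k : (Fin d ⊕ J) × MIdx n,
    ldu deg (k.1, 0) * (((-1 : ℝ) ^ k.2.card) • totalDerivs deg k.2 (duDeriv deg k b))

end LocalAlgebra

/-! ### Part 2: graded bundles, local forms and vertical local vector fields -/

/-- A coordinate chart of `Y₀` adapted to the projection `π₀ : Y₀ → M`: it covers a chart of `M`,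
and both charts are onto the model space. -/
structure FibredChart {n d : ℕ} {M : Type u} [TopologicalSpace M]
    [ChartedSpace (EuclideanSpace ℝ (Fin n)) M] {Y₀ : Type v} [TopologicalSpace Y₀]
    [ChartedSpace (EuclideanSpace ℝ (Fin n) × EuclideanSpace ℝ (Fin d)) Y₀] (π₀ : Y₀ → M) where
  /-- the chart of the base -/
  base : OpenPartialHomeomorph M (EuclideanSpace ℝ (Fin n))
  /-- the chart of the total space -/
  total : OpenPartialHomeomorph Y₀ (EuclideanSpace ℝ (Fin n) × EuclideanSpace ℝ (Fin d))
  base_mem : base ∈ IsManifold.maximalAtlas (𝓡 n) ∞ M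
  total_mem : total ∈ IsManifold.maximalAtlas
    𝓘(ℝ, EuclideanSpace ℝ (Fin n) × EuclideanSpace ℝ (Fin d)) ∞ Y₀
  base_target : base.target = Set.univ
  total_target : total.target = Set.univ
  proj_mem : ∀ y ∈ total.source, π₀ y ∈ base.source
  proj_eq : ∀ y ∈ total.source, (total y).1 = base (π₀ y)

/-- A graded bundle `Y → Y₀ → M`: a smooth fibred manifold `Y₀ → M` (for instance a fibre bundle,
such as an affine bundle), and a graded vector bundle `Y → Y₀` of finite rank, given by its
homogeneous parts `E i`, whose fibre coordinates have the nonzero ghost number `deg i`. -/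
structure GradedBundle (n : ℕ) (M : Type u) [TopologicalSpace M]
    [ChartedSpace (EuclideanSpace ℝ (Fin n)) M] where
  /-- fibre dimension of `Y₀` -/
  d : ℕ
  /-- the part of degree zero -/
  Y₀ : Type v
  [topY₀ : TopologicalSpace Y₀]
  [chartedY₀ : ChartedSpace (EuclideanSpace ℝ (Fin n) × EuclideanSpace ℝ (Fin d)) Y₀]
  [manifoldY₀ : IsManifold 𝓘(ℝ, EuclideanSpace ℝ (Fin n) × EuclideanSpace ℝ (Fin d)) ∞ Y₀]
  /-- the projection -/
  π₀ : Y₀ → M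
  fibred : ∀ y : Y₀, ∃ c : FibredChart (n := n) (d := d) π₀, y ∈ c.total.source
  /-- index set of the homogeneous parts -/
  Part : Type
  [finPart : Fintype Part]
  /-- ghost number of the fibre coordinates of a homogeneous part -/
  deg : Part → ℤ
  deg_ne_zero : ∀ i, deg i ≠ 0
  /-- rank of a homogeneous part -/
  rk : Part → ℕ
  /-- the homogeneous parts -/
  E : Part → Y₀ → Type w
  [topTotal : ∀ i, TopologicalSpace (Bundle.TotalSpace (Fin (rk i) → ℝ) (E i))]
  [topFib : ∀ i y, TopologicalSpace (E i y)]
  [addFib : ∀ i y, AddCommGroup (E i y)]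
  [modFib : ∀ i y, Module ℝ (E i y)]
  [fiberBundle : ∀ i, FiberBundle (Fin (rk i) → ℝ) (E i)]
  [vectorBundle : ∀ i, VectorBundle ℝ (Fin (rk i) → ℝ) (E i)]
  [smoothBundle : ∀ i, ContMDiffVectorBundle ∞ (Fin (rk i) → ℝ) (E i)
    𝓘(ℝ, EuclideanSpace ℝ (Fin n) × EuclideanSpace ℝ (Fin d))]

attribute [instance] GradedBundle.topY₀ GradedBundle.chartedY₀ GradedBundle.manifoldY₀
  GradedBundle.finPart GradedBundle.topTotal GradedBundle.topFib GradedBundle.addFib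
  GradedBundle.modFib GradedBundle.fiberBundle GradedBundle.vectorBundle GradedBundle.smoothBundle

section Global

variable {n : ℕ} {M : Type u} [TopologicalSpace M] [ChartedSpace (EuclideanSpace ℝ (Fin n)) M]

/-- Fibre coordinates of nonzero ghost number. -/
abbrev GradedBundle.J (Y : GradedBundle.{u, v, w} n M) : Type := Σ i : Y.Part, Fin (Y.rk i)

/-- Their ghost numbers. -/
def GradedBundle.degJ (Y : GradedBundle.{u, v, w} n M) (j : Y.J) : ℤ := Y.deg j.1

/-- All fibre coordinates. -/
abbrev GradedBundle.Idx (Y : GradedBundle.{u, v, w} n M) : Type := Fin Y.d ⊕ Y.J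

/-- Points of the infinite jet space in a chart. -/
abbrev GradedBundle.Jets (Y : GradedBundle.{u, v, w} n M) : Type := Jet n Y.d

/-- The algebra of local forms in a chart. -/
abbrev GradedBundle.Loc (Y : GradedBundle.{u, v, w} n M) : Type := LocAlg n Y.d Y.degJ

/-- The algebra of values of local forms at a point. -/
abbrev GradedBundle.Val (Y : GradedBundle.{u, v, w} n M) : Type := FormAlg n Y.d Y.degJ

/-- An adapted chart of a graded bundle: an adapted chart of `Y₀` and, over its domain, linear fibre
coordinates of every homogeneous part. -/
structure GradedBundle.Chart (Y : GradedBundle.{u, v, w} n M) extends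
    FibredChart (n := n) (d := Y.d) Y.π₀ where
  /-- the local trivializations -/
  triv : ∀ i, Bundle.Trivialization (Fin (Y.rk i) → ℝ)
    (Bundle.TotalSpace.proj : Bundle.TotalSpace (Fin (Y.rk i) → ℝ) (Y.E i) → Y.Y₀)
  triv_mem : ∀ i, MemTrivializationAtlas (triv i)
  source_subset : ∀ i, total.source ⊆ (triv i).baseSet

variable {Y : GradedBundle.{u, v, w} n M}

/-- The point of `Y₀` underlying a jet in a chart. -/
def Chart.pt (c : Y.Chart) (z : Y.Jets) : Y.Y₀ :=
  c.total.symm (WithLp.toLp 2 (fun μ => z (Sum.inl μ)),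
    WithLp.toLp 2 (fun a => z (Sum.inr (a, 0))))

/-- The jet `z` in the chart `c` lies over the domain of the chart `c'`. -/
def Overlap (c c' : Y.Chart) (z : Y.Jets) : Prop := Chart.pt c z ∈ c'.total.source

/-- The derivative `∂y^μ/∂x^ν` of the coordinates `y` of `c'` by the coordinates `x` of `c` at the
point of `M` with coordinates `x`. -/
def jac (c c' : Y.Chart) (x : EuclideanSpace ℝ (Fin n)) (μ ν : Fin n) : ℝ :=
  fderiv ℝ (fun x => c'.base (c.base.symm x)) x (EuclideanSpace.single ν 1) μ

/-- The base coordinates in `c'` of a jet given in `c`. -/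
def newBase (c c' : Y.Chart) (z : Y.Jets) : EuclideanSpace ℝ (Fin n) := (c'.total (Chart.pt c z)).1

/-- Total derivative of a function on the infinite jet space. -/
def totalRaw (ν : Fin n) (F : Y.Jets → ℝ) (z : Y.Jets) : ℝ :=
  pderivRaw (Sum.inl ν) F z
    + ∑ᶠ k : Fin Y.d × MIdx n, z (Sum.inr (k.1, ν ::ₘ k.2)) * pderivRaw (Sum.inr k) F z

/-- The coordinates `u'^a_w` of `c'` as functions of the jet coordinates of `c`, obtained from `u'^a`
by applying the total derivatives `∑_ν ∂x^ν/∂x'^μ D_ν`. -/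
def newU (c c' : Y.Chart) (a : Fin Y.d) : List (Fin n) → Y.Jets → ℝ
  | [] => fun z => (c'.total (Chart.pt c z)).2 a
  | μ :: w => fun z => ∑ ν : Fin n, jac c' c (newBase c c' z) ν μ * totalRaw ν (newU c c' a w) z

/-- The transition matrix of the linear fibre coordinates, `u'^j = ∑ A^j_k u^k`. -/
def transMat (c c' : Y.Chart) (i : Y.Part) (j k : Fin (Y.rk i)) (y : Y.Y₀) : ℝ :=
  (c'.triv i ⟨y, (c.triv i).symm y (Pi.single k 1)⟩).2 j

/-- The coefficients of the coordinates of nonzero ghost number,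
`u'^j_w = ∑ (newC w (k, K)) u^k_K`, obtained from `u'^j = ∑ A^j_k u^k` by applying the total
derivatives `∑_ν ∂x^ν/∂x'^μ D_ν`. -/
def newC (c c' : Y.Chart) (i : Y.Part) (j : Fin (Y.rk i)) :
    List (Fin n) → Fin (Y.rk i) × MIdx n → Y.Jets → ℝ
  | [] => fun k z => if k.2 = 0 then transMat c c' i j k.1 (Chart.pt c z) else 0
  | μ :: w => fun k z => ∑ ν : Fin n, jac c' c (newBase c c' z) ν μ *
      (totalRaw ν (newC c c' i j w k) z
        + if ν ∈ k.2 then newC c c' i j w (k.1, k.2.erase ν) z else 0)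

/-- The infinite jet in the chart `c'` of a jet given in `c`. -/
def newJet (c c' : Y.Chart) (z : Y.Jets) : Y.Jets
  | Sum.inl μ => newBase c c' z μ
  | Sum.inr (a, I) => newU c c' a I.sort z

/-- The coordinate `u'^j_I` of nonzero ghost number at a jet, in the chart `c`. -/
def newGen (c c' : Y.Chart) (z : Y.Jets) (j : Y.J) (I : MIdx n) : Y.Val :=
  ∑ᶠ k : Fin (Y.rk j.1) × MIdx n,
    newC c c' j.1 j.2 I.sort k z • fgen Y.degJ (Sum.inl (⟨j.1, k.1⟩, k.2))

/-- The derivative of the coordinate `u'^j_I` at a jet in the direction with components `v` in the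
chart `c`.  For `v = δu` this is the vertical one-form `δu'^j_I`. -/
def newTangent (c c' : Y.Chart) (z : Y.Jets) (v : Y.Idx × MIdx n → Y.Val) :
    Y.Idx × MIdx n → Y.Val
  | (Sum.inl a, I) => ∑ᶠ k : Fin Y.d × MIdx n,
      pderivRaw (Sum.inr k) (newU c c' a I.sort) z • v (Sum.inl k.1, k.2)
  | (Sum.inr j, I) =>
      (∑ᶠ k : Fin (Y.rk j.1) × MIdx n,
        newC c c' j.1 j.2 I.sort k z • v (Sum.inr ⟨j.1, k.1⟩, k.2))
      + ∑ᶠ k : Fin (Y.rk j.1) × MIdx n, ∑ᶠ l : Fin Y.d × MIdx n,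
          pderivRaw (Sum.inr l) (newC c c' j.1 j.2 I.sort k) z •
            (v (Sum.inl l.1, l.2) * fgen Y.degJ (Sum.inl (⟨j.1, k.1⟩, k.2)))

/-- The graph of the change of charts on values of local forms at a jet: the smallest subalgebra of
pairs (expression in `c'`, expression in `c`) containing the pairs given by the generators
`dx'^μ`, `u'^j_I` and `δu'^j_I`. -/
def transGraph (c c' : Y.Chart) (z : Y.Jets) : Subalgebra ℝ (Y.Val × Y.Val) :=
  Algebra.adjoin ℝ
    ({b | ∃ μ : Fin n, b = (fdx Y.degJ μ,
        ∑ ν : Fin n, jac c c' (WithLp.toLp 2 (fun κ => z (Sum.inl κ))) μ ν • fdx Y.degJ ν)}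
      ∪ {b | ∃ (j : Y.J) (I : MIdx n), b = (fgen Y.degJ (Sum.inl (j, I)), newGen c c' z j I)}
      ∪ {b | ∃ k : Y.Idx × MIdx n, b = (fgen Y.degJ (Sum.inr k),
          newTangent c c' z (fun l => fgen Y.degJ (Sum.inr l)) k)})

/-- Families of coordinate expressions, one for each adapted chart. -/
abbrev GradedBundle.Form (Y : GradedBundle.{u, v, w} n M) : Type _ := Y.Chart → Y.Loc

/-- A local form: the coordinate expressions match under all changes of adapted charts. -/
def IsLocalForm (θ : Y.Form) : Prop :=
  ∀ (c c' : Y.Chart) (z : Y.Jets), Overlap c c' z →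
    (evalAt Y.degJ (newJet c c' z) (θ c'), evalAt Y.degJ z (θ c)) ∈ transGraph c c' z

/-- `Ω_loc^{p,q,r}`: local forms of horizontal degree `p`, vertical degree `q`, ghost number `r`. -/
def OmegaLoc (Y : GradedBundle.{u, v, w} n M) (p q : ℕ) (r : ℤ) : Set Y.Form :=
  {θ | IsLocalForm θ ∧ ∀ c, θ c ∈ homog Y.degJ p q r}

/-- A vertical local vector field of ghost number `k`, with components `Ξ^j` in every adapted chart;
its components `D_I(Ξ^j)` along `∂/∂u^j_I` match under all changes of adapted charts. -/
structure VField (Y : GradedBundle.{u, v, w} n M) (k : ℤ) where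
  /-- the components -/
  comp : Y.Chart → Y.Idx → Y.Loc
  comp_mem : ∀ c j, comp c j ∈ homog Y.degJ 0 0 (ghostCoord Y.degJ j + k)
  compat : ∀ (c c' : Y.Chart) (z : Y.Jets), Overlap c c' z → ∀ l : Y.Idx × MIdx n,
    (evalAt Y.degJ (newJet c c' z) (totalDerivs Y.degJ l.2 (comp c' l.1)),
      newTangent c c' z
        (fun l => evalAt Y.degJ z (totalDerivs Y.degJ l.2 (comp c l.1))) l) ∈ transGraph c c' z

/-- Horizontal differential. -/
def dh (θ : Y.Form) : Y.Form := fun c => dhLoc Y.degJ (θ c)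

/-- Vertical differential. -/
def dv (θ : Y.Form) : Y.Form := fun c => dvLoc Y.degJ (θ c)

/-- Contraction with a vertical local vector field. -/
def iota {k : ℤ} (Ξ : VField Y k) (θ : Y.Form) : Y.Form := fun c => iotaLoc Y.degJ (Ξ.comp c) (θ c)

/-- Lie derivative along a vertical local vector field, `Lie_Ξ = ι_Ξ d_v + (-1)^k d_v ι_Ξ`. -/
def lie {k : ℤ} (Ξ : VField Y k) (θ : Y.Form) : Y.Form := fun c => lieLoc Y.degJ k (Ξ.comp c) (θ c)

/-- Equality up to a `d_h`-exact term, written `≃`. -/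
def HEquiv (θ₁ θ₂ : Y.Form) : Prop := ∃ α : Y.Form, IsLocalForm α ∧ θ₁ - θ₂ = dh α

/-- A Noether symmetry of the Lagrangian `L`. -/
def IsNoetherSymmetry {k : ℤ} (Ξ : VField Y k) (L : Y.Form) : Prop := HEquiv (lie Ξ L) 0

/-- A cohomological vector field: `Q` has ghost number one and `Q² = 0`, where `Q²` is the vector
field with components `Q(Q^j)`. -/
def IsCohomological (Q : VField Y 1) : Prop :=
  ∀ c j, lieLoc Y.degJ 1 (Q.comp c) (Q.comp c j) = 0

/-- A Lagrangian: a local form of degree `(n, 0, 0)` with compact support along `M`. -/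
def IsLagrangian (L : Y.Form) : Prop :=
  L ∈ OmegaLoc Y n 0 0 ∧ ∃ K : Set M, IsCompact K ∧
    ∀ (c : Y.Chart) (z : Y.Jets), Y.π₀ (Chart.pt c z) ∉ K → evalAt Y.degJ z (L c) = 0

/-- A functional form of vertical degree `s`: a form of horizontal degree `n` that is invariant under
the interior Euler operator. -/
def IsFunctionalForm (s : ℕ) (θ : Y.Form) : Prop :=
  ∀ c, interiorEulerLoc Y.degJ s (θ c) = θ c

/-- A presymplectic local form of horizontal degree `p` and ghost number `r`. -/
def IsPresymplectic (p : ℕ) (r : ℤ) (θ : Y.Form) : Prop :=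
  θ ∈ OmegaLoc Y p 2 r ∧ HEquiv (dv θ) 0 ∧ (p = n → IsFunctionalForm 2 θ)

/-- Nondegeneracy with respect to vertical local vector fields. -/
def IsNondegenerate (θ : Y.Form) : Prop :=
  ∀ (k : ℤ) (Ξ : VField Y k), HEquiv (iota Ξ θ) 0 → ∀ c j, Ξ.comp c j = 0

/-- A BV symplectic local form: a symplectic local form of degree `(n, 2, -1)`. -/
def IsBVSymplectic (θ : Y.Form) : Prop := IsPresymplectic n (-1) θ ∧ IsNondegenerate θ

/-- An ascendant sequence of `α 0`, a local form of degree `(n, q, r)`: local forms `α p` of degree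
`(n - p, q, p + r)` with `(Lie_Q - (-1)^{q + r} d_h) ∑ α p = 0`, written out in each degree. -/
def IsAscendant (Q : VField Y 1) (q : ℕ) (r : ℤ) (α : ℕ → Y.Form) : Prop :=
  (∀ p ≤ n, α p ∈ OmegaLoc Y (n - p) q (p + r)) ∧
  (∀ p < n, lie Q (α p) = ((-1 : ℝ) ^ ((q : ℤ) + r)) • dh (α (p + 1))) ∧
  lie Q (α n) = 0

/-! ### Part 3: extended BV-BFV Lagrangian field theories -/

/-- An `m`-extended BV-BFV Lagrangian field theory with configuration bundle `Y` over the
`n`-manifold `M`.  The sequences are indexed by `0 ≤ p ≤ n`; by convention they vanish for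
`p > n`.  The Lagrangian of the theory is `L 0`. -/
structure ExtendedBVBFV (Y : GradedBundle.{u, v, w} n M) (m : ℕ) where
  /-- the cohomological vector field -/
  Q : VField Y 1
  /-- the Lagrangians `𝓛^(p)` -/
  L : ℕ → Y.Form
  /-- the potentials `γ^(p)` -/
  γ : ℕ → Y.Form
  /-- the presymplectic forms `ω^(p)` -/
  Ω : ℕ → Y.Form
  m_le : m ≤ n
  L_mem : ∀ p ≤ n, L p ∈ OmegaLoc Y (n - p) 0 p
  γ_mem : ∀ p ≤ n, γ p ∈ OmegaLoc Y (n - p) 1 ((p : ℤ) - 1)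
  L_beyond : ∀ p, n < p → L p = 0
  γ_beyond : ∀ p, n < p → γ p = 0
  Ω_beyond : ∀ p, n < p → Ω p = 0
  lagrangian : IsLagrangian (L 0)
  cohomological : IsCohomological Q
  noether : IsNoetherSymmetry Q (L 0)
  symplectic : IsBVSymplectic (Ω 0)
  ascendant : IsAscendant Q 2 (-1) Ω
  potential : ∀ p ≤ m, Ω p = dv (γ p)
  Ω_eq_zero : ∀ p, m < p → Ω p = 0
  descent : ∀ p < n, iota Q (Ω p) = dv (L p) + dh (γ (p + 1))
  descent_top : iota Q (Ω n) = dv (L n)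

/-- The modified Lagrangian `𝓛_CMR^(p) = 2 𝓛^(p) - ι_Q γ^(p)`. -/
def ExtendedBVBFV.LCMR {Y : GradedBundle.{u, v, w} n M} {m : ℕ} (T : ExtendedBVBFV Y m) (p : ℕ) :
    Y.Form := (2 : ℝ) • T.L p - iota T.Q (T.γ p)

end Global

end

end BVBFV

/-! Fix a chart and write ι for ι_Q. With the sign rule used here d_h commutes with d_v and with ι,
the contraction ι is an even derivation, and Q² = 0 makes ι commute with Lie_Q. Since ω^(p) is
d_v-closed, Lie_Q ω^(p) = -d_v ι ω^(p). Comparing this with `ascendant` and `descent` gives d_h d_v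
γ^(p+1) = d_h ω^(p+1), so under d_h one may replace ω^(p+1) by d_v γ^(p+1) even above level m.

Now compute Lie_Q ι ω^(p) twice. Commuting the operators gives -d_h ι ω^(p+1) = -d_h d_v 𝓛^(p+1).
Expanding ι ω^(p) by `descent` gives -d_v ι d_v 𝓛^(p) + d_h ι d_v γ^(p+1) - d_h d_v ι γ^(p+1), whose
middle term is d_h d_v 𝓛^(p+1). Since Lie_Q 𝓛^(p) = ι d_v 𝓛^(p), it follows that d_v (Lie_Q 𝓛^(p) -
d_h 𝓛_CMR^(p+1)) = 0; this is the core of `lieField_eq_dhField`.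

The d_v can be removed because the form in brackets has vertical degree 0 and ghost number p + 1 ≠
0. Contraction with the Euler field weighted by ghost number is a homotopy: its graded commutator
with d_v multiplies a form by its ghost number, so d_v is injective there
(`eq_zero_of_dvField_eq_zero`).

The commutation rules rest on `IsVectorField`: D_μ, d_v, ι_Q and Lie_Q are graded derivations
obeying the chain rule and killing dx. Such operators are closed under graded commutators and are
determined by their values on x, u_I and δu_I, so each rule is checked on coordinates.

For the symmetry statement the primitive 𝓛_CMR^(p+1) must match under changes of charts. Contraction
is pointwise on the jet space, and on the generators of the graph of a change of charts it reduces
to the compatibility of the components of Q (`iotaAt_mem_transGraph`). -/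

namespace BVBFV

noncomputable section

/-! ### Twisted derivations on tensor products and exterior algebras -/

section Leibniz

/-- A linear map satisfying the Leibniz rule twisted by an algebra homomorphism. -/
def IsTwistedDer {A : Type*} [Ring A] [Algebra ℝ A] (σ : A →ₐ[ℝ] A) (X : A →ₗ[ℝ] A) : Prop :=
  ∀ a b, X (a * b) = X a * b + σ a * X b

variable {A B : Type*} [Ring A] [Algebra ℝ A] [Ring B] [Algebra ℝ B]

theorem IsTwistedDer.tensor_right {σ : B →ₐ[ℝ] B} {X : B →ₗ[ℝ] B} (hX : IsTwistedDer σ X) :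
    IsTwistedDer (Algebra.TensorProduct.map (AlgHom.id ℝ A) σ)
      (TensorProduct.map (LinearMap.id : A →ₗ[ℝ] A) X) := by
  intro a b
  induction a with
  | zero => simp
  | add x y hx hy => simp only [add_mul, map_add, hx, hy]; abel
  | tmul a a' =>
    induction b with
    | zero => simp
    | add x y hx hy => simp only [mul_add, map_add, hx, hy]; abel
    | tmul b b' =>
      simp [Algebra.TensorProduct.tmul_mul_tmul, hX a' b', TensorProduct.tmul_add]

theorem IsTwistedDer.tensor_left {σ : A →ₐ[ℝ] A} {X : A →ₗ[ℝ] A} (hX : IsTwistedDer σ X) :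
    IsTwistedDer (Algebra.TensorProduct.map σ (AlgHom.id ℝ B))
      (TensorProduct.map X (LinearMap.id : B →ₗ[ℝ] B)) := by
  intro a b
  induction a with
  | zero => simp
  | add x y hx hy => simp only [add_mul, map_add, hx, hy]; abel
  | tmul a a' =>
    induction b with
    | zero => simp
    | add x y hx hy => simp only [mul_add, map_add, hx, hy]; abel
    | tmul b b' =>
      simp [Algebra.TensorProduct.tmul_mul_tmul, hX a b, TensorProduct.add_tmul]

/-- Moving the contraction past one vector costs one sign, which is the action of `involute` on that
vector; induction on the number of vectors on the left gives the general case. -/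
theorem isTwistedDer_contractLeft {V : Type*} [AddCommGroup V] [Module ℝ V]
    (φ : Module.Dual ℝ V) :
    IsTwistedDer (CliffordAlgebra.involute : ExteriorAlgebra ℝ V →ₐ[ℝ] ExteriorAlgebra ℝ V)
      (CliffordAlgebra.contractLeft φ) := by
  intro a b
  induction a using CliffordAlgebra.left_induction with
  | algebraMap r =>
    rw [CliffordAlgebra.contractLeft_algebraMap_mul, CliffordAlgebra.contractLeft_algebraMap]
    simp
  | add x y hx hy => simp only [add_mul, map_add, hx, hy]; abel
  | ι_mul x v hx =>
    rw [mul_assoc, CliffordAlgebra.contractLeft_ι_mul, hx, CliffordAlgebra.contractLeft_ι_mul]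
    simp only [map_mul, CliffordAlgebra.involute_ι, sub_mul, smul_mul_assoc, mul_add, mul_assoc,
      neg_mul]
    abel

theorem IsTwistedDer.map_one {σ : A →ₐ[ℝ] A} {X : A →ₗ[ℝ] A} (hX : IsTwistedDer σ X) :
    X 1 = 0 := by
  have := hX 1 1
  simpa using this

theorem neg_one_zpow_mul_self (t : ℤ) : ((-1 : ℝ) ^ t) * (-1 : ℝ) ^ t = 1 := by
  rcases Int.even_or_odd t with h | h
  · simp [h.neg_one_zpow]
  · simp [h.neg_one_zpow]

end Leibniz

/-! ### Parity involution and generators of the algebra of local forms -/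

section Chart

variable {n d : ℕ} {J : Type} (deg : J → ℤ)

/-- The parity of a vertical generator. -/
def par (g : VGen n d J) : ℤ := (vdeg g : ℤ) + ghost deg g

open Classical in
/-- The power `t` of the involution of the vertical algebra that changes the sign of the odd
generators. -/
def vsign (t : ℤ) : VertAlg n d deg →ₐ[ℝ] VertAlg n d deg :=
  Algebra.TensorProduct.map (AlgHom.id ℝ _)
    (if Even t then AlgHom.id ℝ _ else CliffordAlgebra.involute)

/-- The power `t` of the vertical parity involution on local forms. -/
def lsign (t : ℤ) : LocAlg n d deg →ₐ[ℝ] LocAlg n d deg :=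
  Algebra.TensorProduct.map (AlgHom.id ℝ _)
    (Algebra.TensorProduct.map (AlgHom.id ℝ _) (vsign deg t))

theorem vsign_vgen (t : ℤ) (g : VGen n d J) :
    vsign deg t (vgen deg g) = ((-1 : ℝ) ^ (t * par deg g)) • vgen deg g := by
  unfold vgen vsign
  by_cases h : EvenGen deg g
  · have : Even (t * par deg g) := Even.mul_left h t
    simp [h, this.neg_one_zpow]
  · have h' : Odd (par deg g) := Int.not_even_iff_odd.mp h
    by_cases ht : Even t
    · simp [h, ht, (ht.mul_right (par deg g)).neg_one_zpow]
    · have ht' := Int.not_even_iff_odd.mp ht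
      simp [h, ht, (ht'.mul h').neg_one_zpow, TensorProduct.tmul_neg]

theorem lsign_lfun (t : ℤ) (f : LocFun n d) : lsign deg t (lfun deg f) = lfun deg f := by
  change Algebra.TensorProduct.map _ _ (f ⊗ₜ[ℝ] (1 : FormAlg n d deg)) = _
  rw [Algebra.TensorProduct.map_tmul, map_one]; rfl

theorem lsign_ldx (t : ℤ) (μ : Fin n) :
    lsign (d := d) deg t (ldx deg μ) = ldx deg μ := by
  change Algebra.TensorProduct.map _ _ ((1 : LocFun n d) ⊗ₜ[ℝ] (fdx deg μ : FormAlg n d deg)) = _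
  rw [Algebra.TensorProduct.map_tmul, map_one, fdx, Algebra.TensorProduct.map_tmul, map_one]
  rfl

theorem lsign_lgen (t : ℤ) (g : VGen n d J) :
    lsign deg t (lgen deg g) = ((-1 : ℝ) ^ (t * par deg g)) • lgen deg g := by
  change Algebra.TensorProduct.map _ _ ((1 : LocFun n d) ⊗ₜ[ℝ] (fgen deg g : FormAlg n d deg)) = _
  rw [Algebra.TensorProduct.map_tmul, map_one, fgen, Algebra.TensorProduct.map_tmul, map_one,
    vsign_vgen, TensorProduct.tmul_smul, TensorProduct.tmul_smul]
  rfl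

theorem vsign_eq {s t : ℤ} (h : Even (s - t)) : vsign (n := n) (d := d) deg s = vsign deg t := by
  have : Even s ↔ Even t := by rw [Int.even_sub] at h; exact h
  simp [vsign, this]

theorem lsign_eq {s t : ℤ} (h : Even (s - t)) : lsign (n := n) (d := d) deg s = lsign deg t := by
  simp [lsign, vsign_eq deg h]

/-- Local functions as a subalgebra of local forms. -/
def lfunHom : LocFun n d →ₐ[ℝ] LocAlg n d deg := Algebra.TensorProduct.includeLeft

theorem lfun_mul (f g : LocFun n d) : lfun deg (f * g) = lfun deg f * lfun deg g :=
  map_mul (lfunHom deg) f g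

theorem lfun_one : lfun deg (1 : LocFun n d) = 1 := map_one (lfunHom deg)

theorem lfun_zero : lfun deg (0 : LocFun n d) = 0 := map_zero (lfunHom deg)

/-- Constant coefficient forms as a subalgebra of local forms. -/
def constHom : FormAlg n d deg →ₐ[ℝ] LocAlg n d deg := Algebra.TensorProduct.includeRight

/-- Together with its analogue for `FormAlg`, this is what reduces every later identity to
generators, through `LocAlg.induction`. -/
theorem VertAlg.adjoin_eq_top :
    Algebra.adjoin ℝ (Set.range (vgen (n := n) (d := d) deg)) = ⊤ := by
  classical
  rw [eq_top_iff]
  rintro x -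
  induction x using TensorProduct.induction_on with
  | zero => exact zero_mem _
  | add x y hx hy => exact add_mem hx hy
  | tmul p e =>
    have h1 : ∀ p : MvPolynomial {g : VGen n d J // EvenGen deg g} ℝ,
        (p ⊗ₜ[ℝ] (1 : ExteriorAlgebra ℝ ({g : VGen n d J // ¬ EvenGen deg g} →₀ ℝ)))
          ∈ Algebra.adjoin ℝ (Set.range (vgen (n := n) (d := d) deg)) := by
      intro p
      induction p using MvPolynomial.induction_on with
      | C r =>
        have : (MvPolynomial.C r : MvPolynomial {g : VGen n d J // EvenGen deg g} ℝ)
            ⊗ₜ[ℝ] (1 : ExteriorAlgebra ℝ ({g : VGen n d J // ¬ EvenGen deg g} →₀ ℝ))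
            = algebraMap ℝ (VertAlg n d deg) r := rfl
        rw [this]
        exact Subalgebra.algebraMap_mem _ r
      | add p q hp hq => rw [TensorProduct.add_tmul]; exact add_mem hp hq
      | mul_X p g hp =>
        have : (p * MvPolynomial.X g)
            ⊗ₜ[ℝ] (1 : ExteriorAlgebra ℝ ({g : VGen n d J // ¬ EvenGen deg g} →₀ ℝ))
            = (p ⊗ₜ 1) * vgen deg g.1 := by
          simp [vgen, g.2, Algebra.TensorProduct.tmul_mul_tmul]
        rw [this]
        exact mul_mem hp (Algebra.subset_adjoin ⟨_, rfl⟩)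
    have h2 : ∀ e : ExteriorAlgebra ℝ ({g : VGen n d J // ¬ EvenGen deg g} →₀ ℝ),
        ((1 : MvPolynomial {g : VGen n d J // EvenGen deg g} ℝ) ⊗ₜ[ℝ] e)
          ∈ Algebra.adjoin ℝ (Set.range (vgen (n := n) (d := d) deg)) := by
      intro e
      induction e using ExteriorAlgebra.induction with
      | algebraMap r =>
        have : (1 : MvPolynomial {g : VGen n d J // EvenGen deg g} ℝ) ⊗ₜ[ℝ]
            (algebraMap ℝ (ExteriorAlgebra ℝ ({g : VGen n d J // ¬ EvenGen deg g} →₀ ℝ)) r)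
            = algebraMap ℝ (VertAlg n d deg) r := by
          rw [Algebra.algebraMap_eq_smul_one, Algebra.algebraMap_eq_smul_one,
            TensorProduct.tmul_smul]
          rfl
        rw [this]
        exact Subalgebra.algebraMap_mem _ r
      | ι v =>
        induction v using Finsupp.induction_linear with
        | zero => simp
        | add f g hf hg => rw [map_add, TensorProduct.tmul_add]; exact add_mem hf hg
        | single g r =>
          have : (1 : MvPolynomial {g : VGen n d J // EvenGen deg g} ℝ) ⊗ₜ[ℝ]
              ExteriorAlgebra.ι ℝ (Finsupp.single g r) = r • vgen deg g.1 := by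
            simp only [vgen, g.2, dite_false]
            rw [← TensorProduct.tmul_smul, ← map_smul, Finsupp.smul_single, smul_eq_mul, mul_one]
          rw [this]
          exact Subalgebra.smul_mem _ (Algebra.subset_adjoin (Set.mem_range_self g.1)) r
      | mul a b ha hb =>
        have : (1 : MvPolynomial {g : VGen n d J // EvenGen deg g} ℝ) ⊗ₜ[ℝ] (a * b)
            = (1 ⊗ₜ a) * (1 ⊗ₜ b) := by simp [Algebra.TensorProduct.tmul_mul_tmul]
        rw [this]
        exact mul_mem ha hb
      | add a b ha hb => rw [TensorProduct.tmul_add]; exact add_mem ha hb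
    have : p ⊗ₜ[ℝ] e = (p ⊗ₜ 1) * (1 ⊗ₜ e) := by simp [Algebra.TensorProduct.tmul_mul_tmul]
    rw [this]
    exact mul_mem (h1 p) (h2 e)

theorem FormAlg.adjoin_eq_top :
    Algebra.adjoin ℝ (Set.range (fdx (n := n) (d := d) deg) ∪ Set.range (fgen deg)) = ⊤ := by
  rw [eq_top_iff]
  rintro x -
  set B := Algebra.adjoin ℝ (Set.range (fdx (n := n) (d := d) deg) ∪ Set.range (fgen deg)) with hB
  have h1 : ∀ e : ExteriorAlgebra ℝ (Fin n →₀ ℝ), e ⊗ₜ[ℝ] (1 : VertAlg n d deg) ∈ B := by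
    intro e
    induction e using ExteriorAlgebra.induction with
    | algebraMap r => exact Subalgebra.algebraMap_mem B r
    | ι v =>
      induction v using Finsupp.induction_linear with
      | zero => simp
      | add f g hf hg => rw [map_add, TensorProduct.add_tmul]; exact add_mem hf hg
      | single g r =>
        have : ExteriorAlgebra.ι ℝ (Finsupp.single g r) ⊗ₜ[ℝ] (1 : VertAlg n d deg)
            = r • fdx deg g := by
          rw [fdx, TensorProduct.smul_tmul', ← map_smul, Finsupp.smul_single, smul_eq_mul, mul_one]
        rw [this]
        exact B.smul_mem (Algebra.subset_adjoin (Or.inl ⟨g, rfl⟩)) r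
    | mul a b ha hb =>
      have : (a * b) ⊗ₜ[ℝ] (1 : VertAlg n d deg) = (a ⊗ₜ 1) * (b ⊗ₜ 1) := by
        rw [Algebra.TensorProduct.tmul_mul_tmul, mul_one]
      rw [this]
      exact mul_mem ha hb
    | add a b ha hb => rw [TensorProduct.add_tmul]; exact add_mem ha hb
  have h2 : ∀ e : VertAlg n d deg, (1 : ExteriorAlgebra ℝ (Fin n →₀ ℝ)) ⊗ₜ[ℝ] e ∈ B := by
    intro e
    have he : e ∈ Algebra.adjoin ℝ (Set.range (vgen (n := n) (d := d) deg)) := by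
      rw [VertAlg.adjoin_eq_top]; trivial
    have := (Algebra.adjoin_le (S := B.comap
      (Algebra.TensorProduct.includeRight : VertAlg n d deg →ₐ[ℝ] FormAlg n d deg)) (by
        rintro _ ⟨g, rfl⟩
        exact Algebra.subset_adjoin (Or.inr ⟨g, rfl⟩))) he
    exact this
  induction x using TensorProduct.induction_on with
  | zero => exact zero_mem _
  | add x y hx hy => exact add_mem hx hy
  | tmul p e =>
    have : p ⊗ₜ[ℝ] e = (p ⊗ₜ 1) * (1 ⊗ₜ e) := by
      rw [Algebra.TensorProduct.tmul_mul_tmul, mul_one, one_mul]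
    rw [this]
    exact mul_mem (h1 p) (h2 e)

/-- Induction on local forms: they are generated by local functions, `dx^μ` and the vertical
generators. -/
theorem LocAlg.induction {P : LocAlg n d deg → Prop} (hf : ∀ f, P (lfun deg f))
    (hx : ∀ μ, P (ldx deg μ)) (hg : ∀ g, P (lgen deg g))
    (hadd : ∀ a b, P a → P b → P (a + b)) (hmul : ∀ a b, P a → P b → P (a * b))
    (a : LocAlg n d deg) : P a := by
  -- Scalars are constant local functions, so they need no case of their own.
  have hc : ∀ r, P (algebraMap ℝ _ r) := fun r => hf (algebraMap ℝ _ r)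
  let B : Subalgebra ℝ (LocAlg n d deg) :=
    { carrier := {a | P a}
      mul_mem' := fun h h' => hmul _ _ h h'
      add_mem' := fun h h' => hadd _ _ h h'
      algebraMap_mem' := hc }
  have h2 : ∀ e : FormAlg n d deg, constHom deg e ∈ B := by
    intro e
    have he : e ∈ Algebra.adjoin ℝ
        (Set.range (fdx (n := n) (d := d) deg) ∪ Set.range (fgen deg)) := by
      rw [FormAlg.adjoin_eq_top]; trivial
    exact (Algebra.adjoin_le (S := B.comap (constHom deg)) (by
      rintro _ (⟨μ, rfl⟩ | ⟨g, rfl⟩)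
      · exact hx μ
      · exact hg g)) he
  change a ∈ B
  induction a using TensorProduct.induction_on with
  | zero => exact zero_mem _
  | add x y hx hy => exact add_mem hx hy
  | tmul p e =>
    have : p ⊗ₜ[ℝ] e = lfun deg p * constHom deg e := by
      change _ = (p ⊗ₜ 1) * (1 ⊗ₜ e)
      rw [Algebra.TensorProduct.tmul_mul_tmul, mul_one, one_mul]
    rw [this]
    exact mul_mem (hf p) (h2 e)

/-- Algebra homomorphisms from local forms agree if they agree on generators. -/
theorem LocAlg.algHom_ext {B : Type*} [Ring B] [Algebra ℝ B] {φ ψ : LocAlg n d deg →ₐ[ℝ] B}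
    (hf : ∀ f, φ (lfun deg f) = ψ (lfun deg f)) (hx : ∀ μ, φ (ldx deg μ) = ψ (ldx deg μ))
    (hg : ∀ g, φ (lgen deg g) = ψ (lgen deg g)) : φ = ψ := by
  refine AlgHom.ext fun a => ?_
  refine LocAlg.induction deg (P := fun a => φ a = ψ a) hf hx hg ?_ ?_ a
  · intro a b ha hb
    rw [map_add, map_add, ha, hb]
  · intro a b ha hb
    rw [map_mul, map_mul, ha, hb]

theorem lsign_even {t : ℤ} (h : Even t) (a : LocAlg n d deg) : lsign deg t a = a := by
  have : lsign (n := n) (d := d) deg t = AlgHom.id ℝ _ := by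
    refine LocAlg.algHom_ext deg (fun f => lsign_lfun deg t f) (fun μ => lsign_ldx deg t μ) ?_
    intro g
    rw [lsign_lgen, (h.mul_right _).neg_one_zpow, one_smul]
    rfl
  rw [this]; rfl

theorem lsign_lsign (s t : ℤ) (a : LocAlg n d deg) :
    lsign deg s (lsign deg t a) = lsign deg (s + t) a := by
  have : (lsign (n := n) (d := d) deg s).comp (lsign deg t) = lsign deg (s + t) := by
    refine LocAlg.algHom_ext deg (fun f => ?_) (fun μ => ?_) (fun g => ?_)
    · simp only [AlgHom.comp_apply, lsign_lfun]
    · simp only [AlgHom.comp_apply, lsign_ldx]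
    · simp only [AlgHom.comp_apply, lsign_lgen, map_smul, smul_smul]
      rw [← zpow_add₀ (by norm_num)]
      ring_nf
  rw [← this]; rfl

end Chart

/-! ### Partial derivatives of local functions -/

section PartialDerivatives

variable {n d : ℕ}

theorem pderivRaw_eq_fderiv {f : Jet n d → ℝ} {S : Finset (Coord n d)} {g : (S → ℝ) → ℝ}
    (hg : ContDiff ℝ ∞ g) (h : ∀ z, f z = g (fun s => z s)) (a : Coord n d) (z : Jet n d) :
    pderivRaw a f z = fderiv ℝ g (fun s => z s) (fun s => if (s : Coord n d) = a then 1 else 0) := by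
  simp only [pderivRaw, h]
  exact (pderivRaw_hasDerivAt hg a z).deriv

theorem pderivFun_mul (a : Coord n d) (f g : LocFun n d) :
    pderivFun a (f * g) = pderivFun a f * g + f * pderivFun a g := by
  ext z
  have := ((IsLocalFun.hasDerivAt f.2 a z).mul (IsLocalFun.hasDerivAt g.2 a z)).deriv
  rw [Function.update_eq_self] at this
  exact this

/-- Both sides are values of the second Fréchet derivative of one finite-dimensional smooth
representative, which is symmetric. -/
theorem pderivFun_comm (a b : Coord n d) (f : LocFun n d) :
    pderivFun a (pderivFun b f) = pderivFun b (pderivFun a f) := by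
  obtain ⟨f, S, g, hg, h⟩ := f
  have key : ∀ (a b : Coord n d) (z : Jet n d), pderivRaw a (pderivRaw b f) z =
      fderiv ℝ (fderiv ℝ g) (fun s => z s) (fun s => if (s : Coord n d) = a then 1 else 0)
        (fun s => if (s : Coord n d) = b then 1 else 0) := by
    intro a b z
    have hg' : ContDiff ℝ ∞ (fderiv ℝ g) := hg.fderiv_right (m := ∞) (by simp)
    rw [pderivRaw_eq_fderiv (S := S)
      (g := fun y => fderiv ℝ g y (fun s => if (s : Coord n d) = b then 1 else 0))
      (hg'.clm_apply contDiff_const) (fun z => pderivRaw_eq_fderiv hg h b z)]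
    rw [fderiv_clm_apply (hg'.differentiable (by simp)).differentiableAt
      (differentiableAt_const _)]
    simp
  ext z
  change pderivRaw a (pderivRaw b f) z = pderivRaw b (pderivRaw a f) z
  rw [key, key]
  have hs : IsSymmSndFDerivAt ℝ g (fun s => z s) :=
    hg.contDiffAt.isSymmSndFDerivAt (by
      rw [minSmoothness_of_isRCLikeNormedField]
      exact ENat.LEInfty.out)
  exact hs.eq _ _

theorem exists_pderivFun_eq_zero (f : LocFun n d) :
    ∃ T : Finset (Coord n d), ∀ a, a ∉ T → pderivFun a f = 0 := by
  obtain ⟨f, S, g, hg, h⟩ := f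
  refine ⟨S, fun a ha => ?_⟩
  ext z
  change pderivRaw a f z = 0
  rw [pderivRaw_eq_fderiv hg h]
  have : (fun s : S => if (s : Coord n d) = a then (1 : ℝ) else 0) = 0 := by
    funext s
    have : (s : Coord n d) ≠ a := fun h => ha (h ▸ s.2)
    simp [this]
  rw [this, map_zero]

theorem pderivFun_coordFun (a b : Coord n d) :
    pderivFun a (coordFun b) = if a = b then 1 else 0 := by
  ext z
  change pderivRaw a (fun z => z b) z = _
  unfold pderivRaw
  split_ifs with h
  · subst h
    simp
  · simp [Function.update_of_ne (Ne.symm h)]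

end PartialDerivatives

/-! ### Supercentral coefficients, graded vector fields and their commutators -/

section Chart

variable {n d : ℕ} {J : Type} (deg : J → ℤ)

instance : Semiring (LocAlg n d deg) := Ring.toSemiring
instance : NonUnitalNonAssocSemiring (LocAlg n d deg) := inferInstance
instance : AddCommGroup (LocAlg n d deg) := inferInstance
instance : AddCommMonoid (LocAlg n d deg) := inferInstance
instance : Module ℝ (LocAlg n d deg) := Algebra.toModule

theorem lfun_commute (f : LocFun n d) (a : LocAlg n d deg) : Commute (lfun deg f) a := by
  refine LocAlg.induction deg (P := fun a => Commute (lfun deg f) a) ?_ ?_ ?_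
    (fun _ _ => Commute.add_right) (fun _ _ => Commute.mul_right) a
  · intro g
    change lfun deg f * lfun deg g = lfun deg g * lfun deg f
    rw [← lfun_mul, mul_comm, lfun_mul]
  · intro μ
    change (f ⊗ₜ[ℝ] (1 : FormAlg n d deg)) * (1 ⊗ₜ fdx deg μ) = (1 ⊗ₜ fdx deg μ) * (f ⊗ₜ 1)
    rw [Algebra.TensorProduct.tmul_mul_tmul, Algebra.TensorProduct.tmul_mul_tmul, one_mul, mul_one,
      one_mul, mul_one]
  · intro μ
    change (f ⊗ₜ[ℝ] (1 : FormAlg n d deg)) * (1 ⊗ₜ fgen deg μ) = (1 ⊗ₜ fgen deg μ) * (f ⊗ₜ 1)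
    rw [Algebra.TensorProduct.tmul_mul_tmul, Algebra.TensorProduct.tmul_mul_tmul, one_mul, mul_one,
      one_mul, mul_one]

theorem fdx_mul_fgen (μ : Fin n) (g : VGen n d J) :
    fdx deg μ * fgen deg g = fgen deg g * fdx deg μ := by
  unfold fdx fgen
  rw [Algebra.TensorProduct.tmul_mul_tmul, Algebra.TensorProduct.tmul_mul_tmul, one_mul, mul_one,
    one_mul, mul_one]

theorem ldx_mul_lgen (μ : Fin n) (g : VGen n d J) :
    ldx deg μ * lgen deg g = lgen deg g * ldx deg μ := by
  change constHom deg (fdx deg μ) * constHom deg (fgen deg g) = _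
  rw [← map_mul, fdx_mul_fgen, map_mul]
  rfl

theorem ldx_mul_ldx (μ ν : Fin n) :
    (ldx deg μ * ldx deg ν : LocAlg n d deg) = - (ldx deg ν * ldx deg μ) := by
  have h : (fdx deg μ * fdx deg ν : FormAlg n d deg) = - (fdx deg ν * fdx deg μ) := by
    unfold fdx
    rw [Algebra.TensorProduct.tmul_mul_tmul, Algebra.TensorProduct.tmul_mul_tmul,
      ← TensorProduct.neg_tmul]
    congr 1
    exact eq_neg_of_add_eq_zero_left (ExteriorAlgebra.ι_add_mul_swap _ _)
  change constHom deg (fdx deg μ) * constHom deg (fdx deg ν) = _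
  rw [← map_mul, h, map_neg, map_mul]
  rfl

theorem vgen_mul_vgen (g h : VGen n d J) :
    vgen deg g * vgen deg h = ((-1 : ℝ) ^ (par deg g * par deg h)) • (vgen deg h * vgen deg g) := by
  unfold vgen
  by_cases hg : EvenGen deg g
  · rw [Even.neg_one_zpow (Even.mul_right (show Even (par deg g) from hg) _), one_smul]
    by_cases hh : EvenGen deg h
    · simp only [hg, hh, dite_true, Algebra.TensorProduct.tmul_mul_tmul, mul_comm]
    · simp only [hg, hh, dite_true, dite_false, Algebra.TensorProduct.tmul_mul_tmul, one_mul,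
        mul_one]
  · by_cases hh : EvenGen deg h
    · rw [Even.neg_one_zpow (Even.mul_left (show Even (par deg h) from hh) _), one_smul]
      simp only [hg, hh, dite_true, dite_false, Algebra.TensorProduct.tmul_mul_tmul, one_mul,
        mul_one]
    · have h1 : Odd (par deg g) := Int.not_even_iff_odd.mp hg
      have h2 : Odd (par deg h) := Int.not_even_iff_odd.mp hh
      rw [Odd.neg_one_zpow (h1.mul h2)]
      simp only [hg, hh, dite_false, Algebra.TensorProduct.tmul_mul_tmul]
      rw [neg_one_smul, ← TensorProduct.tmul_neg]
      congr 1
      exact eq_neg_of_add_eq_zero_left (ExteriorAlgebra.ι_add_mul_swap _ _)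

theorem lgen_mul_lgen (g h : VGen n d J) :
    lgen deg g * lgen deg h = ((-1 : ℝ) ^ (par deg g * par deg h)) • (lgen deg h * lgen deg g) := by
  have hf : fgen deg g * fgen deg h
      = ((-1 : ℝ) ^ (par deg g * par deg h)) • (fgen deg h * fgen deg g) := by
    unfold fgen
    rw [Algebra.TensorProduct.tmul_mul_tmul, Algebra.TensorProduct.tmul_mul_tmul, vgen_mul_vgen,
      TensorProduct.tmul_smul]
  change constHom deg (fgen deg g) * constHom deg (fgen deg h) = _
  rw [← map_mul, hf, map_smul, map_mul]
  rfl

/-- Local forms of vertical parity `t` that supercommute with all local forms. -/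
structure IsSupercentral (t : ℤ) (v : LocAlg n d deg) : Prop where
  swap : ∀ a, v * a = lsign deg t a * v
  sign : ∀ s, lsign deg s v = ((-1 : ℝ) ^ (s * t)) • v

theorem isSupercentral_lfun (f : LocFun n d) : IsSupercentral deg 0 (lfun deg f) where
  swap a := by rw [lsign_even deg (by simp), (lfun_commute deg f a).eq]
  sign s := by rw [lsign_lfun]; simp

theorem isSupercentral_lgen (g : VGen n d J) : IsSupercentral deg (par deg g) (lgen deg g) where
  swap a := by
    refine LocAlg.induction deg
      (P := fun a => lgen deg g * a = lsign deg (par deg g) a * lgen deg g) ?_ ?_ ?_ ?_ ?_ a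
    · intro f
      rw [lsign_lfun, (lfun_commute deg f _).eq]
    · intro μ
      rw [lsign_ldx, ldx_mul_lgen]
    · intro h
      rw [lsign_lgen, lgen_mul_lgen, smul_mul_assoc]
    · intro a b ha hb
      rw [mul_add, ha, hb, map_add, add_mul]
    · intro a b ha hb
      rw [← mul_assoc, ha, mul_assoc, hb, map_mul, mul_assoc]
  sign s := lsign_lgen deg s g

variable {deg}

theorem IsSupercentral.of_even_sub {s t : ℤ} {v : LocAlg n d deg} (hv : IsSupercentral deg s v)
    (h : Even (s - t)) : IsSupercentral deg t v where
  swap a := by rw [hv.swap, lsign_eq deg h]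
  sign r := by
    rw [hv.sign]
    congr 1
    have : r * s = r * t + r * (s - t) := by ring
    rw [this, zpow_add₀ (by norm_num), (h.mul_left r).neg_one_zpow, mul_one]

theorem isSupercentral_zero (t : ℤ) : IsSupercentral deg t (0 : LocAlg n d deg) where
  swap a := by simp
  sign s := by simp

theorem IsSupercentral.add {t : ℤ} {v w : LocAlg n d deg} (hv : IsSupercentral deg t v)
    (hw : IsSupercentral deg t w) : IsSupercentral deg t (v + w) where
  swap a := by rw [add_mul, hv.swap, hw.swap, mul_add]
  sign s := by rw [map_add, hv.sign, hw.sign, smul_add]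

theorem IsSupercentral.smul {t : ℤ} {v : LocAlg n d deg} (hv : IsSupercentral deg t v) (r : ℝ) :
    IsSupercentral deg t (r • v) where
  swap a := by rw [smul_mul_assoc, hv.swap, mul_smul_comm]
  sign s := by rw [map_smul, hv.sign, smul_comm]

theorem IsSupercentral.mul {s t : ℤ} {v w : LocAlg n d deg} (hv : IsSupercentral deg s v)
    (hw : IsSupercentral deg t w) : IsSupercentral deg (s + t) (v * w) where
  swap a := by
    rw [mul_assoc, hw.swap, ← mul_assoc, hv.swap, lsign_lsign, mul_assoc]
  sign r := by
    rw [map_mul, hv.sign, hw.sign, smul_mul_smul_comm, mul_add, zpow_add₀ (by norm_num)]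

variable (deg)

/-- A vertical vector field of parity `t` acting on local forms: a graded derivation that acts on
functions by the chain rule. -/
structure IsVectorField (t : ℤ) (X : LocAlg n d deg →ₗ[ℝ] LocAlg n d deg) : Prop where
  leibniz : ∀ a b, X (a * b) = X a * b + lsign deg t a * X b
  sign : ∀ s a, X (lsign deg s a) = ((-1 : ℝ) ^ (s * t)) • lsign deg s (X a)
  chain : ∀ (f : LocFun n d) (T : Finset (Coord n d)), (∀ a, a ∉ T → pderivFun a f = 0) →
    X (lfun deg f) = ∑ a ∈ T, lfun deg (pderivFun a f) * X (lfun deg (coordFun a))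
  ldx : ∀ μ, X (ldx deg μ) = 0

variable {deg}

/-- The parity condition is stable under sums and, by the Leibniz rule, under products, so it only
has to be tested on generators. -/
theorem sign_of_leibniz {t : ℤ} {X : LocAlg n d deg →ₗ[ℝ] LocAlg n d deg}
    (hX : ∀ a b, X (a * b) = X a * b + lsign deg t a * X b)
    (hf : ∀ s f, X (lfun deg f) = ((-1 : ℝ) ^ (s * t)) • lsign deg s (X (lfun deg f)))
    (hx : ∀ μ, X (ldx deg μ) = 0)
    (hg : ∀ s g, X (lsign deg s (lgen deg g)) = ((-1 : ℝ) ^ (s * t)) • lsign deg s (X (lgen deg g)))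
    (s : ℤ) (a : LocAlg n d deg) :
    X (lsign deg s a) = ((-1 : ℝ) ^ (s * t)) • lsign deg s (X a) := by
  refine LocAlg.induction deg
    (P := fun a => X (lsign deg s a) = ((-1 : ℝ) ^ (s * t)) • lsign deg s (X a)) ?_ ?_ ?_ ?_ ?_ a
  · intro f
    rw [lsign_lfun]
    exact hf s f
  · intro μ
    rw [lsign_ldx, hx, map_zero, smul_zero]
  · exact hg s
  · intro a b ha hb
    rw [map_add, map_add, ha, hb, map_add, map_add, smul_add]
  · intro a b ha hb
    rw [map_mul, hX, hX, ha, hb, map_add, map_mul, map_mul, lsign_lsign, lsign_lsign, smul_add,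
      smul_mul_assoc, mul_smul_comm, add_comm s t]

namespace IsVectorField

variable {s t : ℤ} {X X' : LocAlg n d deg →ₗ[ℝ] LocAlg n d deg}

theorem of_even_sub (hX : IsVectorField deg s X) (h : Even (s - t)) : IsVectorField deg t X where
  leibniz a b := by rw [hX.leibniz, lsign_eq deg h]
  sign r a := by
    rw [hX.sign]
    congr 1
    have : r * s = r * t + r * (s - t) := by ring
    rw [this, zpow_add₀ (by norm_num), (h.mul_left r).neg_one_zpow, mul_one]
  chain := hX.chain
  ldx := hX.ldx

theorem map_one (hX : IsVectorField deg t X) : X 1 = 0 :=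
  IsTwistedDer.map_one (σ := lsign deg t) hX.leibniz

theorem add (hX : IsVectorField deg t X) (hX' : IsVectorField deg t X') :
    IsVectorField deg t (X + X') where
  leibniz a b := by
    simp only [LinearMap.add_apply, hX.leibniz, hX'.leibniz, add_mul, mul_add]
    abel
  sign r a := by simp only [LinearMap.add_apply, hX.sign, hX'.sign, map_add, smul_add]
  chain f T hT := by
    simp only [LinearMap.add_apply, hX.chain f T hT, hX'.chain f T hT, mul_add,
      Finset.sum_add_distrib]
  ldx μ := by simp only [LinearMap.add_apply, hX.ldx, hX'.ldx, add_zero]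

/-- Supercentrality of the coefficient is exactly what the Leibniz rule needs: moving v past the
already twisted factor adds the twist s to the twist t. -/
theorem mul_left {v : LocAlg n d deg} (hv : IsSupercentral deg s v) (hX : IsVectorField deg t X) :
    IsVectorField deg (s + t) (LinearMap.mulLeft ℝ (A := LocAlg n d deg) v ∘ₗ X) where
  leibniz a b := by
    simp only [LinearMap.comp_apply, LinearMap.mulLeft_apply, hX.leibniz, mul_add, ← mul_assoc]
    rw [hv.swap (lsign deg t a), lsign_lsign]
  sign r a := by
    simp only [LinearMap.comp_apply, LinearMap.mulLeft_apply, hX.sign, map_mul, hv.sign,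
      smul_mul_assoc, mul_smul_comm, smul_smul]
    rw [mul_add, zpow_add₀ (by norm_num), mul_right_comm, neg_one_zpow_mul_self, one_mul]
  chain f T hT := by
    simp only [LinearMap.comp_apply, LinearMap.mulLeft_apply, hX.chain f T hT, Finset.mul_sum,
      ← mul_assoc]
    refine Finset.sum_congr rfl fun a _ => ?_
    rw [(lfun_commute deg (pderivFun a f) v).eq]
  ldx μ := by simp only [LinearMap.comp_apply, LinearMap.mulLeft_apply, hX.ldx, mul_zero]

/-- Apply X to the relation v a = ± a v. The terms containing X a agree by supercentrality of v and
cancel, leaving the relation for X v. -/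
theorem supercentral (hX : IsVectorField deg t X) {v : LocAlg n d deg}
    (hv : IsSupercentral deg s v) : IsSupercentral deg (t + s) (X v) where
  swap a := by
    have h1 := congrArg X (hv.swap a)
    rw [hX.leibniz, hX.leibniz, hv.sign, hX.sign, lsign_lsign, smul_mul_assoc, smul_mul_assoc,
      hv.swap (X a), mul_comm t s, add_comm (_ • _)] at h1
    exact add_right_cancel h1
  sign r := by
    have h1 := hX.sign r v
    rw [hv.sign, map_smul] at h1
    have h2 := congrArg (fun x => ((-1 : ℝ) ^ (r * t)) • x) h1
    simp only [smul_smul] at h2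
    rw [neg_one_zpow_mul_self, one_smul] at h2
    rw [← h2, mul_add, zpow_add₀ (by norm_num)]

theorem map_lfun_supercentral (hX : IsVectorField deg t X) (f : LocFun n d) :
    IsSupercentral deg t (X (lfun deg f)) := by
  simpa using hX.supercentral (isSupercentral_lfun deg f)

/-- Vector fields agree if they agree on the coordinates and their vertical differentials. -/
theorem eq_zero (hX : IsVectorField deg t X) (hc : ∀ a, X (lfun deg (coordFun a)) = 0)
    (hg : ∀ g, X (lgen deg g) = 0) (a : LocAlg n d deg) : X a = 0 := by
  refine LocAlg.induction deg (P := fun a => X a = 0) ?_ hX.ldx hg ?_ ?_ a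
  · intro f
    obtain ⟨T, hT⟩ := exists_pderivFun_eq_zero f
    rw [hX.chain f T hT]
    exact Finset.sum_eq_zero fun a _ => by rw [hc, mul_zero]
  · intro a b ha hb
    rw [map_add, ha, hb, add_zero]
  · intro a b ha hb
    rw [hX.leibniz, ha, hb, zero_mul, mul_zero, add_zero]

/-- This is the classical reason why a commutator of first-order operators has order one: the terms
with second partial derivatives of f cancel by symmetry. -/
theorem commutator_chain (hX : IsVectorField deg s X) (hX' : IsVectorField deg t X')
    (f : LocFun n d) (T : Finset (Coord n d)) (hT : ∀ a, a ∉ T → pderivFun a f = 0) :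
    X (X' (lfun deg f)) - ((-1 : ℝ) ^ (s * t)) • X' (X (lfun deg f)) =
      ∑ a ∈ T, lfun deg (pderivFun a f) * (X (X' (lfun deg (coordFun a)))
        - ((-1 : ℝ) ^ (s * t)) • X' (X (lfun deg (coordFun a)))) := by
  -- The same finite set T serves for the first derivatives of f, so both chain rules run over one
  -- index set.
  have hT' : ∀ b a, a ∉ T → pderivFun a (pderivFun b f) = 0 := by
    intro b a ha
    rw [pderivFun_comm, hT a ha, map_zero]
  -- The second-order terms: after exchanging the two summation indices they differ only by the sign
  -- of swapping the supercentral values of X and X' on coordinates.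
  have key : ∑ a ∈ T, X (lfun deg (pderivFun a f)) * X' (lfun deg (coordFun a)) =
      ((-1 : ℝ) ^ (s * t)) •
        ∑ a ∈ T, X' (lfun deg (pderivFun a f)) * X (lfun deg (coordFun a)) := by
    simp only [fun b => hX.chain _ T (hT' b), fun b => hX'.chain _ T (hT' b), Finset.sum_mul,
      Finset.smul_sum]
    rw [Finset.sum_comm]
    refine Finset.sum_congr rfl fun a _ => Finset.sum_congr rfl fun b _ => ?_
    rw [mul_assoc, mul_assoc, (hX.map_lfun_supercentral (coordFun a)).swap,
      (hX'.map_lfun_supercentral (coordFun b)).sign, smul_mul_assoc, mul_smul_comm,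
      pderivFun_comm]
  rw [hX'.chain f T hT, hX.chain f T hT, map_sum, map_sum]
  simp only [hX.leibniz, hX'.leibniz, lsign_lfun, mul_sub, Finset.sum_sub_distrib,
    Finset.sum_add_distrib, mul_smul_comm, ← Finset.smul_sum, smul_add]
  rw [key, add_sub_add_left_eq_sub]

/-- The graded commutator of vector fields. -/
theorem commutator (hX : IsVectorField deg s X) (hX' : IsVectorField deg t X') :
    IsVectorField deg (s + t) (X ∘ₗ X' - ((-1 : ℝ) ^ (s * t)) • (X' ∘ₗ X)) where
  leibniz a b := by
    simp only [LinearMap.sub_apply, LinearMap.smul_apply, LinearMap.comp_apply, hX.leibniz,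
      hX'.leibniz, map_add, hX.sign, hX'.sign, lsign_lsign, smul_add, mul_smul_comm, sub_mul,
      mul_sub, smul_mul_assoc, smul_smul]
    rw [mul_comm t s, neg_one_zpow_mul_self, one_smul, add_comm t s]
    abel
  sign r a := by
    simp only [LinearMap.sub_apply, LinearMap.smul_apply, LinearMap.comp_apply, hX.sign,
      hX'.sign, map_smul, map_sub, smul_smul, smul_sub]
    rw [mul_add, zpow_add₀ (by norm_num), mul_comm ((-1 : ℝ) ^ (r * s)),
      mul_comm ((-1 : ℝ) ^ (s * t)), mul_comm ((-1 : ℝ) ^ (r * t)) ((-1 : ℝ) ^ (r * s))]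
  chain f T hT := commutator_chain hX hX' f T hT
  ldx μ := by
    simp only [LinearMap.sub_apply, LinearMap.smul_apply, LinearMap.comp_apply, hX.ldx, hX'.ldx,
      map_zero, smul_zero, sub_zero]

end IsVectorField

end Chart

/-! ### Coordinate derivatives and locally finite sums of vector fields -/

section Chart

variable {n d : ℕ} {J : Type} (deg : J → ℤ)

/-- An even generator gives an ordinary derivation of the polynomial factor; an odd one gives a
contraction of the exterior factor, twisted by its involution. -/
theorem vpderiv_isTwistedDer (g : VGen n d J) :
    IsTwistedDer (vsign deg (par deg g)) (vpderiv deg g) := by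
  unfold vpderiv vsign
  by_cases h : EvenGen deg g
  · have h' : Even (par deg g) := h
    simp only [h, h', dite_true, if_true]
    refine IsTwistedDer.tensor_left (σ := AlgHom.id ℝ _) fun a b => ?_
    change MvPolynomial.pderiv _ (a * b) = MvPolynomial.pderiv _ a * b + a * MvPolynomial.pderiv _ b
    rw [Derivation.leibniz, smul_eq_mul, smul_eq_mul, add_comm, mul_comm b]
  · have h' : ¬ Even (par deg g) := h
    simp only [h, h', dite_false, if_false]
    exact IsTwistedDer.tensor_right (isTwistedDer_contractLeft _)

open Classical in
theorem vpderiv_vgen (g h : VGen n d J) :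
    vpderiv deg g (vgen deg h) = if g = h then 1 else 0 := by
  by_cases hgh : g = h
  · subst hgh
    rw [if_pos rfl]
    unfold vpderiv vgen
    by_cases hg : EvenGen deg g
    · simp only [hg, dite_true, TensorProduct.map_tmul, LinearMap.id_apply]
      change MvPolynomial.pderiv _ (MvPolynomial.X _) ⊗ₜ[ℝ] _ = _
      rw [MvPolynomial.pderiv_X_self]
      rfl
    · simp only [hg, dite_false, TensorProduct.map_tmul, LinearMap.id_apply]
      have : CliffordAlgebra.contractLeft (Finsupp.lapply
          (⟨g, hg⟩ : {g : VGen n d J // ¬ EvenGen deg g}))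
          (ExteriorAlgebra.ι ℝ (Finsupp.single ⟨g, hg⟩ (1 : ℝ))) = 1 := by
        refine (CliffordAlgebra.contractLeft_ι _ _ _).trans ?_
        simp
      exact congrArg (fun x => (1 : MvPolynomial {g : VGen n d J // EvenGen deg g} ℝ) ⊗ₜ[ℝ] x) this
  · rw [if_neg hgh]
    unfold vpderiv vgen
    by_cases hg : EvenGen deg g <;> by_cases hh : EvenGen deg h <;>
      simp only [hg, hh, dite_true, dite_false, TensorProduct.map_tmul, LinearMap.id_apply]
    · change MvPolynomial.pderiv _ (MvPolynomial.X _) ⊗ₜ[ℝ] _ = _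
      rw [MvPolynomial.pderiv_X_of_ne (by simpa using Ne.symm hgh), TensorProduct.zero_tmul]
    · change MvPolynomial.pderiv _ 1 ⊗ₜ[ℝ] _ = _
      rw [Derivation.map_one_eq_zero, TensorProduct.zero_tmul]
    · rw [CliffordAlgebra.contractLeft_one, TensorProduct.tmul_zero]
    · have : CliffordAlgebra.contractLeft (Finsupp.lapply
          (⟨g, hg⟩ : {g : VGen n d J // ¬ EvenGen deg g}))
          (ExteriorAlgebra.ι ℝ (Finsupp.single ⟨h, hh⟩ (1 : ℝ))) = 0 := by
        refine (CliffordAlgebra.contractLeft_ι _ _ _).trans ?_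
        simp [Ne.symm hgh]
      exact (congrArg (fun x => (1 : MvPolynomial {g : VGen n d J // EvenGen deg g} ℝ) ⊗ₜ[ℝ] x)
        this).trans (TensorProduct.tmul_zero _ _)

theorem genDeriv_leibniz (g : VGen n d J) :
    IsTwistedDer (lsign deg (par deg g)) (genDeriv deg g) :=
  IsTwistedDer.tensor_right (IsTwistedDer.tensor_right (vpderiv_isTwistedDer deg g))

open Classical in
theorem genDeriv_lgen (g h : VGen n d J) :
    genDeriv deg g (lgen deg h) = if g = h then 1 else 0 := by
  change (1 : LocFun n d) ⊗ₜ[ℝ] ((1 : ExteriorAlgebra ℝ (Fin n →₀ ℝ)) ⊗ₜ[ℝ]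
    (vpderiv deg g (vgen deg h))) = _
  rw [vpderiv_vgen]
  split_ifs
  · rfl
  · rw [TensorProduct.tmul_zero, TensorProduct.tmul_zero]

theorem genDeriv_lfun (g : VGen n d J) (f : LocFun n d) : genDeriv deg g (lfun deg f) = 0 := by
  change f ⊗ₜ[ℝ] ((1 : ExteriorAlgebra ℝ (Fin n →₀ ℝ)) ⊗ₜ[ℝ] (vpderiv deg g 1)) = _
  rw [(vpderiv_isTwistedDer deg g).map_one, TensorProduct.tmul_zero, TensorProduct.tmul_zero]

theorem genDeriv_ldx (g : VGen n d J) (μ : Fin n) : genDeriv deg g (ldx deg μ) = 0 := by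
  change (1 : LocFun n d) ⊗ₜ[ℝ] (ExteriorAlgebra.ι ℝ (Finsupp.single μ 1) ⊗ₜ[ℝ]
    (vpderiv deg g 1)) = _
  rw [(vpderiv_isTwistedDer deg g).map_one, TensorProduct.tmul_zero, TensorProduct.tmul_zero]

theorem coeffDeriv_lfun (a : Coord n d) (f : LocFun n d) :
    coeffDeriv deg a (lfun deg f) = lfun deg (pderivFun a f) := rfl

theorem coeffDeriv_const (a : Coord n d) (x : FormAlg n d deg) :
    coeffDeriv deg a ((1 : LocFun n d) ⊗ₜ x) = 0 := by
  have h : pderivFun a (1 : LocFun n d) = 0 := by simpa using pderivFun_mul a (1 : LocFun n d) 1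
  change (pderivFun a (1 : LocFun n d)) ⊗ₜ[ℝ] x = 0
  rw [h, TensorProduct.zero_tmul]

theorem coeffDeriv_ldx (a : Coord n d) (μ : Fin n) :
    coeffDeriv deg a (ldx deg μ) = 0 := coeffDeriv_const deg a _

theorem coeffDeriv_lgen (a : Coord n d) (g : VGen n d J) :
    coeffDeriv deg a (lgen deg g) = 0 := coeffDeriv_const deg a _

theorem genDeriv_isVectorField (g : VGen n d J) :
    IsVectorField deg (par deg g) (genDeriv deg g) := by
  classical
  refine ⟨genDeriv_leibniz deg g, ?_, ?_, genDeriv_ldx deg g⟩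
  · refine sign_of_leibniz (genDeriv_leibniz deg g) ?_ (genDeriv_ldx deg g) ?_
    · intro s f
      rw [genDeriv_lfun, map_zero, smul_zero]
    · intro s h
      rw [lsign_lgen, map_smul, genDeriv_lgen]
      split_ifs with hgh
      · rw [hgh, map_one]
      · rw [map_zero, smul_zero, smul_zero]
  · intro f T _
    simp only [genDeriv_lfun, mul_zero, Finset.sum_const_zero]

theorem coeffDeriv_isVectorField (a : Coord n d) :
    IsVectorField deg 0 (coeffDeriv deg a) := by
  have hl : ∀ x y : LocAlg n d deg, coeffDeriv deg a (x * y)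
      = coeffDeriv deg a x * y + lsign deg 0 x * coeffDeriv deg a y := by
    intro x y
    have h : IsTwistedDer (AlgHom.id ℝ (LocFun n d)) (pderivFun a) := fun f g => pderivFun_mul a f g
    have := h.tensor_left (B := FormAlg n d deg) x y
    rw [Algebra.TensorProduct.map_id] at this
    rw [lsign_even deg Even.zero]
    exact this
  refine ⟨hl, ?_, ?_, coeffDeriv_ldx deg a⟩
  · refine sign_of_leibniz hl ?_ (coeffDeriv_ldx deg a) ?_
    · intro s f
      rw [coeffDeriv_lfun, lsign_lfun, mul_zero, zpow_zero, one_smul]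
    · intro s h
      rw [lsign_lgen, map_smul, coeffDeriv_lgen, map_zero, smul_zero, smul_zero]
  · intro f T hT
    simp only [coeffDeriv_lfun, pderivFun_coordFun]
    by_cases ha : a ∈ T
    · rw [Finset.sum_eq_single a]
      · rw [if_pos rfl, lfun_one, mul_one]
      · intro b _ hb
        rw [if_neg (Ne.symm hb), lfun_zero, mul_zero]
      · exact fun h => absurd ha h
    · rw [hT a ha, lfun_zero]
      refine (Finset.sum_eq_zero fun b hb => ?_).symm
      rw [if_neg (by rintro rfl; exact ha hb), lfun_zero, mul_zero]

/-- A family of linear maps on local forms is locally finite if only finitely many members act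
nontrivially on any given form. -/
def LocallyFiniteFamily {K : Type} (F : K → LocAlg n d deg →ₗ[ℝ] LocAlg n d deg) : Prop :=
  ∀ b, (Function.support fun k => F k b).Finite

variable {deg}

/-- The sum of a locally finite family. -/
def LocallyFiniteFamily.sum {K : Type} {F : K → LocAlg n d deg →ₗ[ℝ] LocAlg n d deg}
    (hF : LocallyFiniteFamily deg F) : LocAlg n d deg →ₗ[ℝ] LocAlg n d deg where
  toFun b := ∑ᶠ k, F k b
  map_add' a b := by
    simp only [map_add]
    exact finsum_add_distrib (hF a) (hF b)
  map_smul' r b := by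
    simp only [map_smul]
    exact (smul_finsum' r (hF b)).symm

theorem LocallyFiniteFamily.sum_apply {K : Type} {F : K → LocAlg n d deg →ₗ[ℝ] LocAlg n d deg}
    (hF : LocallyFiniteFamily deg F) (b : LocAlg n d deg) : hF.sum b = ∑ᶠ k, F k b := rfl

theorem LocallyFiniteFamily.mul_left {K : Type} {F : K → LocAlg n d deg →ₗ[ℝ] LocAlg n d deg}
    (hF : LocallyFiniteFamily deg F) (v : K → LocAlg n d deg) :
    LocallyFiniteFamily deg fun k => LinearMap.mulLeft ℝ (A := LocAlg n d deg) (v k) ∘ₗ F k := by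
  intro b
  refine (hF b).subset fun k hk h => hk ?_
  change v k * F k b = 0
  rw [show F k _ = 0 from h, mul_zero]

/-- By the Leibniz rule a member that kills a and b also kills a b, so the set of active members for
a product lies in the union of those for its factors. -/
theorem LocallyFiniteFamily.of_vectorField {K : Type}
    {F : K → LocAlg n d deg →ₗ[ℝ] LocAlg n d deg} {t : K → ℤ}
    (hF : ∀ k, IsVectorField deg (t k) (F k))
    (hf : ∀ f, (Function.support fun k => F k (lfun deg f)).Finite)
    (hg : ∀ g, (Function.support fun k => F k (lgen deg g)).Finite) :
    LocallyFiniteFamily deg F := by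
  intro b
  refine LocAlg.induction deg (P := fun b => (Function.support fun k => F k b).Finite)
    hf ?_ hg ?_ ?_ b
  · intro μ
    simp only [(hF _).ldx]
    exact (Function.support_zero (M := LocAlg n d deg)).symm ▸ Set.finite_empty
  · intro a b ha hb
    refine (ha.union hb).subset fun k hk => ?_
    by_contra h
    simp only [Set.mem_union, Function.mem_support, not_or, not_not] at h
    exact hk (by simp only [map_add, h.1, h.2, add_zero])
  · intro a b ha hb
    refine (ha.union hb).subset fun k hk => ?_
    by_contra h
    simp only [Set.mem_union, Function.mem_support, not_or, not_not] at h
    exact hk (by simp only [(hF k).leibniz, h.1, h.2, zero_mul, mul_zero, add_zero])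

theorem LocallyFiniteFamily.isVectorField {K : Type}
    {F : K → LocAlg n d deg →ₗ[ℝ] LocAlg n d deg} {t : ℤ} (hF : LocallyFiniteFamily deg F)
    (hv : ∀ k, IsVectorField deg t (F k)) : IsVectorField deg t hF.sum where
  leibniz a b := by
    simp only [hF.sum_apply, (hv _).leibniz]
    rw [finsum_add_distrib, finsum_mul' _ _ (hF a), mul_finsum' _ _ (hF b)]
    · refine (hF a).subset fun k hk h => hk ?_
      change F k a * b = 0
      rw [show F k _ = 0 from h, zero_mul]
    · refine (hF b).subset fun k hk h => hk ?_
      change _ * F k b = 0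
      rw [show F k _ = 0 from h, mul_zero]
  sign s a := by
    simp only [hF.sum_apply, (hv _).sign]
    rw [← smul_finsum' _ (((hF a)).subset _), ← map_finsum _ (hF a)]
    intro k hk h
    exact hk (by simp only [h, map_zero])
  chain f T hT := by
    simp only [hF.sum_apply, (hv _).chain f T hT]
    rw [finsum_sum_comm]
    · refine Finset.sum_congr rfl fun a _ => ?_
      rw [mul_finsum' _ _ (hF _)]
    · intro a _
      refine (hF (lfun deg (coordFun a))).subset fun k hk h => hk ?_
      change _ * F k _ = 0
      rw [show F k _ = 0 from h, mul_zero]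
  ldx μ := by simp only [hF.sum_apply, (hv _).ldx, finsum_zero]

variable (deg)

theorem par_inl (k : J × MIdx n) : par (d := d) deg (Sum.inl k) = deg k.1 := by
  simp [par, vdeg, ghost]

theorem par_inr (k : (Fin d ⊕ J) × MIdx n) :
    par deg (Sum.inr k) = 1 + ghostCoord deg k.1 := by
  simp [par, vdeg, ghost]

theorem duDeriv_isVectorField (k : (Fin d ⊕ J) × MIdx n) :
    IsVectorField deg (1 + ghostCoord deg k.1) (duDeriv deg k) := by
  rw [← par_inr]
  exact genDeriv_isVectorField deg _

theorem uDeriv_isVectorField (k : (Fin d ⊕ J) × MIdx n) :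
    IsVectorField deg (ghostCoord deg k.1) (uDeriv deg k) := by
  obtain ⟨a | j, I⟩ := k
  · exact coeffDeriv_isVectorField deg _
  · have := genDeriv_isVectorField (d := d) deg (Sum.inl (j, I))
    rw [par_inl] at this
    exact this

theorem duDeriv_locallyFinite : LocallyFiniteFamily (n := n) (d := d) deg (duDeriv deg) := by
  classical
  refine LocallyFiniteFamily.of_vectorField (duDeriv_isVectorField deg) ?_ ?_
  · intro f
    simp only [duDeriv, genDeriv_lfun]
    exact (Function.support_zero (M := LocAlg n d deg)).symm ▸ Set.finite_empty
  · intro g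
    refine ((Set.finite_singleton g).preimage (f := Sum.inr) Sum.inr_injective.injOn).subset ?_
    intro k hk
    simp only [duDeriv, genDeriv_lgen, Function.mem_support] at hk
    by_contra h
    exact hk (if_neg h)

/-- A local function involves finitely many jet coordinates, and a generator is hit by at most one
of the derivatives. -/
theorem uDeriv_locallyFinite : LocallyFiniteFamily (n := n) (d := d) deg (uDeriv deg) := by
  classical
  refine LocallyFiniteFamily.of_vectorField (uDeriv_isVectorField deg) ?_ ?_
  · intro f
    obtain ⟨T, hT⟩ := exists_pderivFun_eq_zero f
    refine ((T.finite_toSet.preimage (f := fun p : Fin d × MIdx n => Sum.inr p)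
      Sum.inr_injective.injOn).image (fun p => (Sum.inl p.1, p.2))).subset ?_
    rintro ⟨a | j, I⟩ hk
    · refine ⟨(a, I), ?_, rfl⟩
      by_contra h
      refine hk ?_
      change coeffDeriv deg _ _ = 0
      rw [coeffDeriv_lfun, hT _ h, lfun_zero]
    · exact absurd (genDeriv_lfun deg _ f) hk
  · intro g
    refine (((Set.finite_singleton g).preimage (f := Sum.inl) Sum.inl_injective.injOn).image
      (fun p => (Sum.inr p.1, p.2))).subset ?_
    rintro ⟨a | j, I⟩ hk
    · exact absurd (coeffDeriv_lgen deg _ g) hk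
    · refine ⟨(j, I), ?_, rfl⟩
      by_contra h
      refine hk ?_
      change genDeriv deg _ _ = 0
      exact (genDeriv_lgen deg _ _).trans (if_neg h)

/-- The vector field `∑ v_k ∂/∂u_k`. -/
def uField (v : (Fin d ⊕ J) × MIdx n → LocAlg n d deg) : LocAlg n d deg →ₗ[ℝ] LocAlg n d deg :=
  ((uDeriv_locallyFinite deg).mul_left v).sum

/-- The vector field `∑ v_k ∂/∂(δu_k)`. -/
def duField (v : (Fin d ⊕ J) × MIdx n → LocAlg n d deg) : LocAlg n d deg →ₗ[ℝ] LocAlg n d deg :=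
  ((duDeriv_locallyFinite deg).mul_left v).sum

variable {deg}

theorem uField_isVectorField {v : (Fin d ⊕ J) × MIdx n → LocAlg n d deg} {t : ℤ}
    (hv : ∀ k, IsSupercentral deg (t + ghostCoord deg k.1) (v k)) :
    IsVectorField deg t (uField deg v) := by
  refine LocallyFiniteFamily.isVectorField _ fun k => ?_
  -- Coefficient and derivative contribute the ghost number of u_k once each, so the parity of the
  -- k-th term differs from t by twice that number.
  refine ((uDeriv_isVectorField deg k).mul_left (hv k)).of_even_sub ⟨ghostCoord deg k.1, ?_⟩
  ring

theorem duField_isVectorField {v : (Fin d ⊕ J) × MIdx n → LocAlg n d deg} {t : ℤ}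
    (hv : ∀ k, IsSupercentral deg (t + 1 + ghostCoord deg k.1) (v k)) :
    IsVectorField deg t (duField deg v) := by
  refine LocallyFiniteFamily.isVectorField _ fun k => ?_
  refine ((duDeriv_isVectorField deg k).mul_left (hv k)).of_even_sub ⟨1 + ghostCoord deg k.1, ?_⟩
  ring

open Classical in
theorem uDeriv_lu (k l : (Fin d ⊕ J) × MIdx n) :
    uDeriv deg k (lu deg l) = if k = l then 1 else 0 := by
  obtain ⟨a | j, I⟩ := k <;> obtain ⟨b | j', I'⟩ := l
  · change coeffDeriv deg _ (lfun deg _) = _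
    rw [coeffDeriv_lfun, pderivFun_coordFun]
    simp only [Sum.inr.injEq, Prod.mk.injEq, Sum.inl.injEq]
    split_ifs
    · exact lfun_one deg
    · exact lfun_zero deg
  · simp only [Prod.mk.injEq, reduceCtorEq, false_and, if_false]
    exact coeffDeriv_lgen deg _ _
  · simp only [Prod.mk.injEq, reduceCtorEq, false_and, if_false]
    exact genDeriv_lfun deg _ _
  · change genDeriv deg _ (lgen deg _) = _
    rw [genDeriv_lgen]
    simp only [Sum.inl.injEq, Prod.mk.injEq, Sum.inr.injEq]

theorem uDeriv_ldu (k l : (Fin d ⊕ J) × MIdx n) : uDeriv deg k (ldu deg l) = 0 := by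
  classical
  obtain ⟨a | j, I⟩ := k
  · exact coeffDeriv_lgen deg _ _
  · change genDeriv deg _ (lgen deg _) = _
    rw [genDeriv_lgen, if_neg (by simp)]

theorem uDeriv_x (k : (Fin d ⊕ J) × MIdx n) (μ : Fin n) :
    uDeriv deg k (lfun deg (coordFun (Sum.inl μ))) = 0 := by
  obtain ⟨a | j, I⟩ := k
  · change coeffDeriv deg _ (lfun deg _) = _
    rw [coeffDeriv_lfun, pderivFun_coordFun, if_neg (by simp), lfun_zero]
  · exact genDeriv_lfun deg _ _

theorem duDeriv_lu (k l : (Fin d ⊕ J) × MIdx n) : duDeriv deg k (lu deg l) = 0 := by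
  classical
  obtain ⟨b | j', I'⟩ := l
  · exact genDeriv_lfun deg _ _
  · change genDeriv deg _ (lgen deg _) = _
    rw [genDeriv_lgen, if_neg (by simp)]

open Classical in
theorem duDeriv_ldu (k l : (Fin d ⊕ J) × MIdx n) :
    duDeriv deg k (ldu deg l) = if k = l then 1 else 0 := by
  change genDeriv deg _ (lgen deg _) = _
  rw [genDeriv_lgen]
  simp only [Sum.inr.injEq]

section Values

variable (v : (Fin d ⊕ J) × MIdx n → LocAlg n d deg)

theorem uField_apply (b : LocAlg n d deg) : uField deg v b = ∑ᶠ k, v k * uDeriv deg k b := rfl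

theorem duField_apply (b : LocAlg n d deg) : duField deg v b = ∑ᶠ k, v k * duDeriv deg k b := rfl

theorem uField_lu (l : (Fin d ⊕ J) × MIdx n) : uField deg v (lu deg l) = v l := by
  classical
  rw [uField_apply, finsum_eq_single _ l]
  · rw [uDeriv_lu, if_pos rfl, mul_one]
  · intro k hk
    rw [uDeriv_lu, if_neg hk, mul_zero]

theorem uField_ldu (l : (Fin d ⊕ J) × MIdx n) : uField deg v (ldu deg l) = 0 := by
  simp only [uField_apply, uDeriv_ldu, mul_zero, finsum_zero]

theorem uField_x (μ : Fin n) : uField deg v (lfun deg (coordFun (Sum.inl μ))) = 0 := by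
  simp only [uField_apply, uDeriv_x, mul_zero, finsum_zero]

theorem duField_lu (l : (Fin d ⊕ J) × MIdx n) : duField deg v (lu deg l) = 0 := by
  simp only [duField_apply, duDeriv_lu, mul_zero, finsum_zero]

theorem duField_ldu (l : (Fin d ⊕ J) × MIdx n) : duField deg v (ldu deg l) = v l := by
  classical
  rw [duField_apply, finsum_eq_single _ l]
  · rw [duDeriv_ldu, if_pos rfl, mul_one]
  · intro k hk
    rw [duDeriv_ldu, if_neg hk, mul_zero]

theorem duField_lfun (f : LocFun n d) : duField deg v (lfun deg f) = 0 := by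
  simp only [duField_apply, duDeriv, genDeriv_lfun, mul_zero, finsum_zero]

end Values

/-- A vector field vanishes if it kills the coordinates and their vertical differentials. -/
theorem IsVectorField.ext_zero {t : ℤ} {X : LocAlg n d deg →ₗ[ℝ] LocAlg n d deg}
    (hX : IsVectorField deg t X) (hx : ∀ μ, X (lfun deg (coordFun (Sum.inl μ))) = 0)
    (hu : ∀ k, X (lu deg k) = 0) (hdu : ∀ k, X (ldu deg k) = 0) (a : LocAlg n d deg) : X a = 0 := by
  refine hX.eq_zero ?_ ?_ a
  · rintro (μ | ⟨a, I⟩)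
    · exact hx μ
    · exact hu (Sum.inl a, I)
  · rintro (⟨j, I⟩ | k)
    · exact hu (Sum.inr j, I)
    · exact hdu k

end Chart

/-! ### Cartan calculus of D_μ, d_v, ι_Q, Lie_Q and d_h in one chart -/

section Chart

variable {n d : ℕ} {J : Type} (deg : J → ℤ)

theorem isSupercentral_lu (k : (Fin d ⊕ J) × MIdx n) :
    IsSupercentral deg (ghostCoord deg k.1) (lu deg k) := by
  obtain ⟨a | j, I⟩ := k
  · exact isSupercentral_lfun deg _
  · have := isSupercentral_lgen (d := d) deg (Sum.inl (j, I))
    rw [par_inl] at this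
    exact this

theorem isSupercentral_ldu (k : (Fin d ⊕ J) × MIdx n) :
    IsSupercentral deg (1 + ghostCoord deg k.1) (ldu deg k) := by
  rw [← par_inr]
  exact isSupercentral_lgen deg _

/-- The total derivative as a linear map. -/
def totalField (μ : Fin n) : LocAlg n d deg →ₗ[ℝ] LocAlg n d deg :=
  coeffDeriv deg (Sum.inl μ) + uField deg (fun k => lu deg (k.1, μ ::ₘ k.2))
    + duField deg (fun k => ldu deg (k.1, μ ::ₘ k.2))

theorem totalField_isVectorField (μ : Fin n) :
    IsVectorField (d := d) deg 0 (totalField deg μ) := by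
  refine ((coeffDeriv_isVectorField deg _).add (uField_isVectorField fun k => ?_)).add
    (duField_isVectorField fun k => ?_)
  · rw [zero_add]
    exact isSupercentral_lu deg (k.1, μ ::ₘ k.2)
  · rw [zero_add]
    exact isSupercentral_ldu deg (k.1, μ ::ₘ k.2)

/-- The vertical differential as a linear map. -/
def dvField : LocAlg n d deg →ₗ[ℝ] LocAlg n d deg := uField deg (ldu deg)

theorem dvField_isVectorField : IsVectorField (n := n) (d := d) deg 1 (dvField deg) :=
  uField_isVectorField (isSupercentral_ldu deg)

/-- The contraction with a vertical local vector field as a linear map. -/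
def iotaField (Ξ : Fin d ⊕ J → LocAlg n d deg) : LocAlg n d deg →ₗ[ℝ] LocAlg n d deg :=
  duField deg fun k => totalDerivs deg k.2 (Ξ k.1)

theorem totalDerivs_induction {P : LocAlg n d deg → Prop}
    (hP : ∀ μ b, P b → P (totalField deg μ b)) {b : LocAlg n d deg} (hb : P b) (I : MIdx n) :
    P (totalDerivs deg I b) := by
  unfold totalDerivs
  induction I.sort with
  | nil => exact hb
  | cons μ l ih => exact hP μ _ ih

variable {deg}

theorem IsSupercentral.totalDerivs {t : ℤ} {v : LocAlg n d deg} (hv : IsSupercentral deg t v)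
    (I : MIdx n) : IsSupercentral deg t (totalDerivs deg I v) := by
  refine totalDerivs_induction deg (P := IsSupercentral deg t) (fun μ b hb => ?_) hv I
  have := (totalField_isVectorField deg μ).supercentral hb
  rwa [zero_add] at this

/-- The components have ghost number shifted by 1 and replace one-forms δu, which carry an extra
parity 1. The two shifts cancel, so contraction with an odd field is an even derivation and obeys
the Leibniz rule without signs. -/
theorem iotaField_isVectorField {Ξ : Fin d ⊕ J → LocAlg n d deg}
    (hΞ : ∀ j, IsSupercentral deg (ghostCoord deg j + 1) (Ξ j)) :
    IsVectorField deg 0 (iotaField deg Ξ) := by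
  refine duField_isVectorField fun k => ?_
  have := (hΞ k.1).totalDerivs k.2
  rwa [zero_add, add_comm]

variable (deg)

theorem totalField_x (μ ν : Fin n) :
    totalField (d := d) deg μ (lfun deg (coordFun (Sum.inl ν))) = if μ = ν then 1 else 0 := by
  unfold totalField
  rw [LinearMap.add_apply, LinearMap.add_apply, uField_x, duField_lfun, coeffDeriv_lfun,
    pderivFun_coordFun, add_zero, add_zero]
  simp only [Sum.inl.injEq]
  split_ifs
  · exact lfun_one deg
  · exact lfun_zero deg

theorem totalField_lu (μ : Fin n) (k : (Fin d ⊕ J) × MIdx n) :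
    totalField deg μ (lu deg k) = lu deg (k.1, μ ::ₘ k.2) := by
  unfold totalField
  rw [LinearMap.add_apply, LinearMap.add_apply, uField_lu, duField_lu, add_zero]
  obtain ⟨a | j, I⟩ := k
  · have : coeffDeriv deg (Sum.inl μ) (lfun (d := d) deg (coordFun (Sum.inr (a, I)))) = 0 := by
      rw [coeffDeriv_lfun, pderivFun_coordFun, if_neg (by simp), lfun_zero]
    change coeffDeriv deg (Sum.inl μ) (lfun deg (coordFun (Sum.inr (a, I)))) + _ = _
    rw [this, zero_add]
  · change coeffDeriv deg (Sum.inl μ) (lgen deg _) + _ = _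
    rw [coeffDeriv_lgen, zero_add]

theorem totalField_ldu (μ : Fin n) (k : (Fin d ⊕ J) × MIdx n) :
    totalField deg μ (ldu deg k) = ldu deg (k.1, μ ::ₘ k.2) := by
  unfold totalField
  rw [LinearMap.add_apply, LinearMap.add_apply, uField_ldu, duField_ldu, add_zero, ldu,
    coeffDeriv_lgen, zero_add]

theorem dvField_lu (k : (Fin d ⊕ J) × MIdx n) : dvField deg (lu deg k) = ldu deg k :=
  uField_lu _ k

theorem dvField_ldu (k : (Fin d ⊕ J) × MIdx n) : dvField deg (ldu deg k) = 0 :=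
  uField_ldu _ k

theorem dvField_x (μ : Fin n) : dvField (d := d) deg (lfun deg (coordFun (Sum.inl μ))) = 0 :=
  uField_x _ μ

variable {deg}

/-- An even vector field commutes with a vector field if it does so on coordinates. -/
theorem IsVectorField.comm_of_generators {t : ℤ} {X X' : LocAlg n d deg →ₗ[ℝ] LocAlg n d deg}
    (hX : IsVectorField deg 0 X) (hX' : IsVectorField deg t X')
    (hx : ∀ μ, X (X' (lfun deg (coordFun (Sum.inl μ)))) = X' (X (lfun deg (coordFun (Sum.inl μ)))))
    (hu : ∀ k, X (X' (lu deg k)) = X' (X (lu deg k)))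
    (hdu : ∀ k, X (X' (ldu deg k)) = X' (X (ldu deg k))) (a : LocAlg n d deg) :
    X (X' a) = X' (X a) := by
  have h : ∀ a, (X ∘ₗ X' - ((-1 : ℝ) ^ (0 * t)) • (X' ∘ₗ X)) a = X (X' a) - X' (X a) := by
    intro a
    simp only [LinearMap.sub_apply, LinearMap.comp_apply, zero_mul, zpow_zero, one_smul]
  refine sub_eq_zero.mp ((h a).symm.trans ((hX.commutator hX').ext_zero ?_ ?_ ?_ a))
  · intro μ
    rw [h, hx, sub_self]
  · intro k
    rw [h, hu, sub_self]
  · intro k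
    rw [h, hdu, sub_self]

variable (deg)

/-- On u_I and δu_I both orders adjoin μ and ν to the multi-index, and multisets forget the order.
-/
theorem totalField_comm (μ ν : Fin n) (a : LocAlg n d deg) :
    totalField deg μ (totalField deg ν a) = totalField deg ν (totalField deg μ a) := by
  -- The first total derivative of a base coordinate is a Kronecker delta, which the second one
  -- kills.
  have h1 : ∀ (μ : Fin n) (c : Prop) [Decidable c],
      totalField (d := d) deg μ (if c then 1 else 0) = 0 := by
    intro μ c _
    split_ifs
    · exact (totalField_isVectorField deg μ).map_one
    · exact map_zero _
  refine (totalField_isVectorField deg μ).comm_of_generators (totalField_isVectorField deg ν)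
    ?_ ?_ ?_ a
  · intro κ
    rw [totalField_x, totalField_x, h1, h1]
  · intro k
    simp only [totalField_lu, Multiset.cons_swap μ ν]
  · intro k
    simp only [totalField_ldu, Multiset.cons_swap μ ν]

theorem totalField_dvField (μ : Fin n) (a : LocAlg n d deg) :
    totalField deg μ (dvField deg a) = dvField deg (totalField deg μ a) := by
  refine (totalField_isVectorField deg μ).comm_of_generators (dvField_isVectorField deg) ?_ ?_ ?_ a
  · intro ν
    rw [dvField_x, totalField_x, map_zero]
    split_ifs
    · rw [(dvField_isVectorField deg).map_one]
    · rw [map_zero]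
  · intro k
    rw [dvField_lu, totalField_lu, dvField_lu, totalField_ldu]
  · intro k
    rw [dvField_ldu, totalField_ldu, dvField_ldu, map_zero]

/-- For an odd operator the graded commutator with itself is twice its square. This is again a
vector field, and it vanishes on x, u_I and δu_I. -/
theorem dvField_dvField (a : LocAlg n d deg) : dvField deg (dvField deg a) = 0 := by
  let D : LocAlg n d deg →ₗ[ℝ] LocAlg n d deg := dvField deg
  have hv := (dvField_isVectorField (n := n) (d := d) deg).commutator (dvField_isVectorField deg)
  have h : ∀ a, (D ∘ₗ D - ((-1 : ℝ) ^ ((1 : ℤ) * 1)) • (D ∘ₗ D)) a = (2 : ℝ) • D (D a) := by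
    intro a
    change D (D a) - ((-1 : ℝ) ^ ((1 : ℤ) * 1)) • D (D a) = _
    rw [mul_one, zpow_one, neg_one_smul, sub_neg_eq_add, two_smul]
  have h2 : (2 : ℝ) • D (D a) = 0 := by
    rw [← h]
    refine hv.ext_zero ?_ ?_ ?_ a
    · intro μ
      rw [h, show D _ = 0 from dvField_x deg μ, map_zero, smul_zero]
    · intro k
      rw [h, show D _ = _ from dvField_lu deg k, show D _ = 0 from dvField_ldu deg k, smul_zero]
    · intro k
      rw [h, show D _ = 0 from dvField_ldu deg k, map_zero, smul_zero]
  have h3 := congrArg (fun x => (2⁻¹ : ℝ) • x) h2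
  simp only [smul_smul, smul_zero] at h3
  rwa [inv_mul_cancel₀ two_ne_zero, one_smul] at h3

/-- Since total derivatives commute, the sorted order chosen to define the iterated derivative is
immaterial. -/
theorem totalDerivs_cons (μ : Fin n) (I : MIdx n) (b : LocAlg n d deg) :
    totalDerivs deg (μ ::ₘ I) b = totalField deg μ (totalDerivs deg I b) := by
  have hl : LeftCommutative (totalDeriv (d := d) deg : Fin n → _ → _) :=
    ⟨fun μ ν a => totalField_comm deg μ ν a⟩
  have hp : List.Perm (μ ::ₘ I).sort (μ :: I.sort) := by
    rw [← Multiset.coe_eq_coe, Multiset.sort_eq, ← Multiset.cons_coe, Multiset.sort_eq]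
  change List.foldr (totalDeriv deg) b _ = List.foldr (totalDeriv deg) b (μ :: I.sort)
  exact hp.foldr_eq b

section Contraction

variable {Ξ : Fin d ⊕ J → LocAlg n d deg}

theorem iotaField_ldu (k : (Fin d ⊕ J) × MIdx n) :
    iotaField deg Ξ (ldu deg k) = totalDerivs deg k.2 (Ξ k.1) := duField_ldu _ k

theorem iotaField_lu (k : (Fin d ⊕ J) × MIdx n) : iotaField deg Ξ (lu deg k) = 0 := duField_lu _ k

theorem iotaField_lfun (f : LocFun n d) : iotaField deg Ξ (lfun deg f) = 0 := duField_lfun _ f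

variable (hΞ : ∀ j, IsSupercentral deg (ghostCoord deg j + 1) (Ξ j))
include hΞ

/-- This is where the prolonged form of the field enters: its component along u_I is D_I Ξ, so on
δu_I the claim becomes D_μ D_I Ξ = D_{I ∪ μ} Ξ. -/
theorem totalField_iotaField (μ : Fin n) (a : LocAlg n d deg) :
    totalField deg μ (iotaField deg Ξ a) = iotaField deg Ξ (totalField deg μ a) := by
  refine (totalField_isVectorField deg μ).comm_of_generators (iotaField_isVectorField hΞ) ?_ ?_ ?_ a
  · intro ν
    rw [iotaField_lfun, totalField_x, map_zero]
    split_ifs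
    · rw [(iotaField_isVectorField hΞ).map_one]
    · rw [map_zero]
  · intro k
    rw [iotaField_lu, totalField_lu, iotaField_lu, map_zero]
  · intro k
    rw [iotaField_ldu, totalField_ldu, iotaField_ldu, totalDerivs_cons]

end Contraction

/-- The Lie derivative along an odd vertical local vector field as a linear map. -/
def lieField (Ξ : Fin d ⊕ J → LocAlg n d deg) : LocAlg n d deg →ₗ[ℝ] LocAlg n d deg :=
  iotaField deg Ξ ∘ₗ dvField deg - dvField deg ∘ₗ iotaField deg Ξ

theorem lieField_apply (Ξ : Fin d ⊕ J → LocAlg n d deg) (b : LocAlg n d deg) :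
    lieField deg Ξ b = iotaField deg Ξ (dvField deg b) - dvField deg (iotaField deg Ξ b) := rfl

theorem lieLoc_eq (Ξ : Fin d ⊕ J → LocAlg n d deg) (b : LocAlg n d deg) :
    lieLoc deg 1 Ξ b = lieField deg Ξ b := by
  rw [lieField_apply, lieLoc, zpow_one, neg_smul, one_smul, ← sub_eq_add_neg]
  rfl

theorem lieField_isVectorField {Ξ : Fin d ⊕ J → LocAlg n d deg}
    (hΞ : ∀ j, IsSupercentral deg (ghostCoord deg j + 1) (Ξ j)) :
    IsVectorField deg 1 (lieField deg Ξ) := by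
  have := (iotaField_isVectorField hΞ).commutator (dvField_isVectorField deg)
  rwa [zero_mul, zpow_zero, one_smul, zero_add] at this

/-- Local forms of vertical degree zero. -/
def IsHorizontal (b : LocAlg n d deg) : Prop := ∀ k, duDeriv deg k b = 0

variable {deg}

theorem IsHorizontal.iotaField {b : LocAlg n d deg} (hb : IsHorizontal deg b)
    (Ξ : Fin d ⊕ J → LocAlg n d deg) : iotaField deg Ξ b = 0 := by
  unfold BVBFV.iotaField
  simp only [duField_apply, hb _, mul_zero, finsum_zero]

variable (deg)

/-- Contraction and Lie derivative along a cohomological vector field commute. -/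
theorem iotaField_lieField {Ξ : Fin d ⊕ J → LocAlg n d deg}
    (hΞ : ∀ j, IsSupercentral deg (ghostCoord deg j + 1) (Ξ j))
    (hhor : ∀ j I, IsHorizontal deg (totalDerivs deg I (Ξ j)))
    (hsq : ∀ j, lieField deg Ξ (Ξ j) = 0) (a : LocAlg n d deg) :
    iotaField deg Ξ (lieField deg Ξ a) = lieField deg Ξ (iotaField deg Ξ a) := by
  have hD : ∀ μ b, totalField deg μ (lieField deg Ξ b) = lieField deg Ξ (totalField deg μ b) := by
    intro μ b
    rw [lieField_apply, map_sub, totalField_iotaField deg hΞ, totalField_dvField,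
      totalField_dvField, totalField_iotaField deg hΞ, lieField_apply]
  -- Q² = 0 is assumed for the components only; it extends to all their total derivatives because
  -- Lie_Q commutes with D_μ.
  have hL : ∀ j I, lieField deg Ξ (totalDerivs deg I (Ξ j)) = 0 := by
    intro j I
    refine totalDerivs_induction deg (P := fun b => lieField deg Ξ b = 0) ?_ (hsq j) I
    intro μ b hb
    rw [← hD, hb, map_zero]
  -- The components have vertical degree zero, so on them Lie_Q is just ι d_v. This is the value
  -- needed on δu_I below.
  have hI : ∀ j I, iotaField deg Ξ (dvField deg (totalDerivs deg I (Ξ j))) = 0 := by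
    intro j I
    have := hL j I
    rwa [lieField_apply, (hhor j I).iotaField, map_zero, sub_zero] at this
  refine (iotaField_isVectorField hΞ).comm_of_generators (lieField_isVectorField deg hΞ) ?_ ?_ ?_ a
  · intro μ
    simp only [lieField_apply, iotaField_lfun, dvField_x, map_zero, sub_zero]
  · intro k
    simp only [lieField_apply, iotaField_lu, dvField_lu, map_zero, sub_zero, iotaField_ldu]
    exact (hhor _ _).iotaField Ξ
  · intro k
    rw [iotaField_ldu, hL, lieField_apply, dvField_ldu, map_zero, zero_sub, iotaField_ldu, map_neg,
      hI, neg_zero]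

/-- The horizontal differential as a linear map. -/
def dhField : LocAlg n d deg →ₗ[ℝ] LocAlg n d deg :=
  ∑ μ : Fin n, LinearMap.mulLeft ℝ (A := LocAlg n d deg) (ldx deg μ) ∘ₗ totalField deg μ

theorem dhField_apply (b : LocAlg n d deg) :
    dhField deg b = ∑ μ : Fin n, ldx deg μ * totalField deg μ b := by
  unfold dhField
  rw [LinearMap.sum_apply]
  rfl

theorem dhLoc_eq (b : LocAlg n d deg) : dhLoc deg b = dhField deg b := (dhField_apply deg b).symm

theorem IsVectorField.ldx_mul {t : ℤ} {X : LocAlg n d deg →ₗ[ℝ] LocAlg n d deg}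
    (hX : IsVectorField deg t X) (μ : Fin n) (b : LocAlg n d deg) :
    X (BVBFV.ldx deg μ * b) = BVBFV.ldx deg μ * X b := by
  rw [hX.leibniz, hX.ldx, lsign_ldx, zero_mul, zero_add]

/-- The operator X kills dx^μ, and the parity involution fixes dx^μ, so X passes through without a
sign. Hence d_h and d_v commute here rather than anticommute. -/
theorem IsVectorField.comm_dhField {t : ℤ} {X : LocAlg n d deg →ₗ[ℝ] LocAlg n d deg}
    (hX : IsVectorField deg t X)
    (h : ∀ μ b, totalField deg μ (X b) = X (totalField deg μ b)) (b : LocAlg n d deg) :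
    dhField deg (X b) = X (dhField deg b) := by
  simp only [dhField_apply, map_sum, h, hX.ldx_mul]

theorem dhField_dvField (b : LocAlg n d deg) :
    dhField deg (dvField deg b) = dvField deg (dhField deg b) :=
  (dvField_isVectorField deg).comm_dhField deg (totalField_dvField deg) b

theorem dhField_iotaField {Ξ : Fin d ⊕ J → LocAlg n d deg}
    (hΞ : ∀ j, IsSupercentral deg (ghostCoord deg j + 1) (Ξ j)) (b : LocAlg n d deg) :
    dhField deg (iotaField deg Ξ b) = iotaField deg Ξ (dhField deg b) :=
  (iotaField_isVectorField hΞ).comm_dhField deg (totalField_iotaField deg hΞ) b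

/-- The products dx^μ dx^ν are antisymmetric while D_μ D_ν is symmetric, so the double sum equals
its own negative. -/
theorem dhField_dhField (b : LocAlg n d deg) : dhField deg (dhField deg b) = 0 := by
  set S := dhField deg (dhField deg b) with hS
  have h1 : S = ∑ μ : Fin n, ∑ ν : Fin n,
      ldx deg μ * ldx deg ν * totalField deg μ (totalField deg ν b) := by
    rw [hS]
    simp only [dhField_apply, map_sum, (totalField_isVectorField deg _).ldx_mul, mul_assoc]
    exact Finset.sum_comm
  have h2 : S = -S := by
    conv_lhs => rw [h1, Finset.sum_comm]
    rw [h1, ← Finset.sum_neg_distrib]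
    refine Finset.sum_congr rfl fun μ _ => ?_
    rw [← Finset.sum_neg_distrib]
    refine Finset.sum_congr rfl fun ν _ => ?_
    rw [ldx_mul_ldx, totalField_comm, neg_mul]
  have h3 : (2 : ℝ) • S = 0 := by
    rw [two_smul]
    nth_rewrite 2 [h2]
    exact add_neg_cancel S
  have h4 := congrArg (fun x => (2⁻¹ : ℝ) • x) h3
  simp only [smul_smul, smul_zero] at h4
  rwa [inv_mul_cancel₀ two_ne_zero, one_smul] at h4

end Chart

/-! ### Tridegrees, and injectivity of d_v at nonzero ghost number -/

section Chart

variable {n d : ℕ} {J : Type} (deg : J → ℤ)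

/-- Local forms of horizontal degree `p`, vertical degree `q` and ghost number `r`, for an integer
`q`. -/
def homogInt (p : ℕ) (q r : ℤ) : Submodule ℝ (LocAlg n d deg) :=
  Submodule.span ℝ {b | ∃ (f : LocFun n d) (μs : List (Fin n)) (gs : List (VGen n d J)),
    μs.length = p ∧ ((gs.map vdeg).sum : ℤ) = q ∧ (gs.map (ghost deg)).sum = r ∧
    b = lfun deg f * (μs.map fun μ => (ldx deg μ : LocAlg n d deg)).prod *
      (gs.map (lgen deg)).prod}

theorem homog_eq_homogInt (p q : ℕ) (r : ℤ) :
    homog (n := n) (d := d) deg p q r = homogInt deg p q r := by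
  simp only [homog, homogInt, Nat.cast_inj]

variable {deg}

theorem monomial_mem_homogInt (f : LocFun n d) (μs : List (Fin n)) (gs : List (VGen n d J)) :
    lfun deg f * (μs.map fun μ => (ldx deg μ : LocAlg n d deg)).prod * (gs.map (lgen deg)).prod ∈
      homogInt deg μs.length ((gs.map vdeg).sum : ℤ) (gs.map (ghost deg)).sum :=
  Submodule.subset_span ⟨f, μs, gs, rfl, rfl, rfl, rfl⟩

theorem mem_homogInt_congr {p p' : ℕ} {q q' r r' : ℤ} {b : LocAlg n d deg}
    (h : b ∈ homogInt deg p q r) (hp : p = p') (hq : q = q') (hr : r = r') :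
    b ∈ homogInt deg p' q' r' := by
  subst hp hq hr
  exact h

theorem lfun_mem_homogInt (f : LocFun n d) : lfun deg f ∈ homogInt deg 0 0 0 := by
  have h := monomial_mem_homogInt (deg := deg) f [] []
  simp only [List.map_nil, List.prod_nil, mul_one] at h
  exact h

theorem ldx_mem_homogInt (μ : Fin n) : (ldx deg μ : LocAlg n d deg) ∈ homogInt deg 1 0 0 := by
  have h := monomial_mem_homogInt (d := d) (deg := deg) 1 [μ] []
  simp only [List.map_nil, List.prod_nil, mul_one, List.map_cons, List.prod_cons, lfun_one,
    one_mul] at h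
  exact h

theorem lgen_mem_homogInt (g : VGen n d J) :
    lgen deg g ∈ homogInt deg 0 (vdeg g) (ghost deg g) := by
  have h := monomial_mem_homogInt (deg := deg) 1 [] [g]
  simp only [List.map_nil, List.prod_nil, mul_one, List.map_cons, List.prod_cons, lfun_one,
    one_mul, List.sum_cons, List.sum_nil, add_zero] at h
  exact h

theorem ldu_mem_homogInt (k : (Fin d ⊕ J) × MIdx n) :
    ldu deg k ∈ homogInt deg 0 1 (ghostCoord deg k.1) := lgen_mem_homogInt (Sum.inr k)

theorem lu_mem_homogInt (k : (Fin d ⊕ J) × MIdx n) :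
    lu deg k ∈ homogInt deg 0 0 (ghostCoord deg k.1) := by
  obtain ⟨a | j, I⟩ := k
  · exact lfun_mem_homogInt _
  · exact lgen_mem_homogInt (Sum.inl (j, I))

theorem one_mem_homogInt : (1 : LocAlg n d deg) ∈ homogInt deg 0 0 0 := by
  rw [← lfun_one]
  exact lfun_mem_homogInt 1

theorem ldx_prod_commute (μs : List (Fin n)) (gs : List (VGen n d J)) :
    Commute (gs.map (lgen deg)).prod (μs.map fun μ => (ldx deg μ : LocAlg n d deg)).prod := by
  refine Commute.list_prod_left _ _ fun x hx => Commute.list_prod_right _ _ fun y hy => ?_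
  obtain ⟨g, -, rfl⟩ := List.mem_map.mp hx
  obtain ⟨μ, -, rfl⟩ := List.mem_map.mp hy
  exact (ldx_mul_lgen deg μ g).symm

/-- A product of two monomials is again a monomial in normal order, without a sign, since functions
and dx^μ commute with all vertical generators. -/
theorem mul_mem_homogInt {p p' : ℕ} {q q' r r' : ℤ} {a b : LocAlg n d deg}
    (ha : a ∈ homogInt deg p q r) (hb : b ∈ homogInt deg p' q' r') :
    a * b ∈ homogInt deg (p + p') (q + q') (r + r') := by
  unfold homogInt at ha hb
  induction ha, hb using Submodule.span_induction₂ with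
  | mem_mem x y hx hy =>
    obtain ⟨f, μs, gs, rfl, rfl, rfl, rfl⟩ := hx
    obtain ⟨f', μs', gs', rfl, rfl, rfl, rfl⟩ := hy
    refine Submodule.subset_span ⟨f * f', μs ++ μs', gs ++ gs', by simp, by simp, by simp, ?_⟩
    simp only [lfun_mul, List.map_append, List.prod_append, mul_assoc]
    congr 1
    rw [← mul_assoc (gs.map (lgen deg)).prod, ← (lfun_commute deg f' _).eq, mul_assoc,
      ← mul_assoc (gs.map (lgen deg)).prod, (ldx_prod_commute μs' gs).eq, ← mul_assoc,
      ← (lfun_commute deg f' _).eq, mul_assoc, mul_assoc]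
  | zero_left y hy => rw [zero_mul]; exact zero_mem _
  | zero_right x hx => rw [mul_zero]; exact zero_mem _
  | add_left x y z hx hy hz h1 h2 => rw [add_mul]; exact add_mem h1 h2
  | add_right x y z hx hy hz h1 h2 => rw [mul_add]; exact add_mem h1 h2
  | smul_left r x y hx hy h => rw [smul_mul_assoc]; exact Submodule.smul_mem _ _ h
  | smul_right r x y hx hy h => rw [mul_smul_comm]; exact Submodule.smul_mem _ _ h

theorem prod_lgen_mem_homogInt (gs : List (VGen n d J)) :
    (gs.map (lgen deg)).prod ∈
      homogInt deg 0 ((gs.map vdeg).sum : ℤ) (gs.map (ghost deg)).sum := by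
  have h := monomial_mem_homogInt (deg := deg) 1 [] gs
  simp only [List.map_nil, List.prod_nil, mul_one, lfun_one, one_mul] at h
  exact h

theorem lsign_ldx_prod (s : ℤ) (μs : List (Fin n)) :
    lsign deg s (μs.map fun μ => (ldx deg μ : LocAlg n d deg)).prod
      = (μs.map fun μ => (ldx deg μ : LocAlg n d deg)).prod := by
  rw [map_list_prod, List.map_map]
  congr 1
  exact List.map_congr_left fun μ _ => lsign_ldx deg s μ

theorem IsVectorField.map_ldx_prod {t : ℤ} {X : LocAlg n d deg →ₗ[ℝ] LocAlg n d deg}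
    (hX : IsVectorField deg t X) (μs : List (Fin n)) :
    X (μs.map fun μ => (BVBFV.ldx deg μ : LocAlg n d deg)).prod = 0 := by
  induction μs with
  | nil => exact hX.map_one
  | cons μ μs ih =>
    rw [List.map_cons, List.prod_cons, hX.leibniz, hX.ldx, ih, zero_mul, mul_zero, add_zero]

/-- A vector field that shifts the degrees of all generators shifts the degrees of all forms. -/
theorem IsVectorField.map_mem_homogInt {t : ℤ} {X : LocAlg n d deg →ₗ[ℝ] LocAlg n d deg}
    (hX : IsVectorField deg t X) {q' r' : ℤ}
    (hx : ∀ μ, X (lfun deg (coordFun (Sum.inl μ))) ∈ homogInt deg 0 q' r')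
    (hu : ∀ k, X (lu deg k) ∈ homogInt deg 0 q' (ghostCoord deg k.1 + r'))
    (hdu : ∀ k, X (ldu deg k) ∈ homogInt deg 0 (1 + q') (ghostCoord deg k.1 + r'))
    {p : ℕ} {q r : ℤ} {b : LocAlg n d deg} (hb : b ∈ homogInt deg p q r) :
    X b ∈ homogInt deg p (q + q') (r + r') := by
  have hg : ∀ g, X (lgen deg g) ∈ homogInt deg 0 (vdeg g + q') (ghost deg g + r') := by
    rintro (⟨j, I⟩ | k)
    · exact mem_homogInt_congr (hu (Sum.inr j, I)) rfl (by simp [vdeg]) rfl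
    · exact mem_homogInt_congr (hdu k) rfl (by simp [vdeg]) rfl
  have hf : ∀ f, X (lfun deg f) ∈ homogInt deg 0 q' r' := by
    intro f
    obtain ⟨T, hT⟩ := exists_pderivFun_eq_zero f
    rw [hX.chain f T hT]
    refine Submodule.sum_mem _ fun a _ => ?_
    have : X (lfun deg (coordFun a)) ∈ homogInt deg 0 q' r' := by
      obtain μ | ⟨a, I⟩ := a
      · exact hx μ
      · exact mem_homogInt_congr (hu (Sum.inl a, I)) rfl rfl (by simp [ghostCoord])
    simpa only [zero_add] using mul_mem_homogInt (lfun_mem_homogInt (pderivFun a f)) this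
  have hgs : ∀ gs : List (VGen n d J), X (gs.map (lgen deg)).prod ∈
      homogInt deg 0 ((gs.map vdeg).sum + q') ((gs.map (ghost deg)).sum + r') := by
    intro gs
    induction gs with
    | nil =>
      have : X (([] : List (VGen n d J)).map (lgen deg)).prod = 0 := hX.map_one
      rw [this]
      exact zero_mem _
    | cons g gs ih =>
      have : X ((g :: gs).map (lgen deg)).prod = _ := hX.leibniz (lgen deg g) _
      rw [this, lsign_lgen, smul_mul_assoc]
      refine add_mem ?_ (Submodule.smul_mem _ _ ?_)
      · refine mem_homogInt_congr (mul_mem_homogInt (hg g) (prod_lgen_mem_homogInt gs)) rfl ?_ ?_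
        · simp only [List.map_cons, List.sum_cons, Nat.cast_add]; ring
        · simp only [List.map_cons, List.sum_cons]; ring
      · refine mem_homogInt_congr (mul_mem_homogInt (lgen_mem_homogInt g) ih) rfl ?_ ?_
        · simp only [List.map_cons, List.sum_cons, Nat.cast_add]; ring
        · simp only [List.map_cons, List.sum_cons]; ring
  unfold homogInt at hb
  induction hb using Submodule.span_induction with
  | mem x hx =>
    obtain ⟨f, μs, gs, rfl, rfl, rfl, rfl⟩ := hx
    have hμ : (μs.map fun μ => (BVBFV.ldx deg μ : LocAlg n d deg)).prod
        ∈ homogInt deg μs.length 0 0 := by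
      have h := monomial_mem_homogInt (d := d) (deg := deg) 1 μs []
      simp only [List.map_nil, List.prod_nil, mul_one, lfun_one, one_mul] at h
      exact h
    rw [hX.leibniz, hX.leibniz, hX.map_ldx_prod, mul_zero, add_zero, map_mul, lsign_lfun,
      lsign_ldx_prod]
    refine add_mem ?_ ?_
    · exact mem_homogInt_congr (mul_mem_homogInt (mul_mem_homogInt (hf f) hμ)
        (prod_lgen_mem_homogInt gs)) (by ring) (by ring) (by ring)
    · exact mem_homogInt_congr (mul_mem_homogInt (mul_mem_homogInt (lfun_mem_homogInt f) hμ)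
        (hgs gs)) (by ring) (by ring) (by ring)
  | zero => rw [map_zero]; exact zero_mem _
  | add x y _ _ h1 h2 => rw [map_add]; exact add_mem h1 h2
  | smul r x _ h => rw [map_smul]; exact Submodule.smul_mem _ _ h

/-- A vector field that kills functions and multiplies every generator by its ghost number
multiplies every form by its ghost number. -/
theorem IsVectorField.eq_ghost_smul {X : LocAlg n d deg →ₗ[ℝ] LocAlg n d deg}
    (hX : IsVectorField deg 0 X) (hf : ∀ a, X (lfun deg (coordFun a)) = 0)
    (hg : ∀ g, X (lgen deg g) = (ghost deg g : ℝ) • lgen deg g)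
    {p : ℕ} {q r : ℤ} {b : LocAlg n d deg} (hb : b ∈ homogInt deg p q r) : X b = (r : ℝ) • b := by
  have hl : ∀ a b, X (a * b) = X a * b + a * X b := by
    intro a b
    rw [hX.leibniz, lsign_even deg Even.zero]
  have hf' : ∀ f, X (lfun deg f) = 0 := by
    intro f
    obtain ⟨T, hT⟩ := exists_pderivFun_eq_zero f
    rw [hX.chain f T hT]
    exact Finset.sum_eq_zero fun a _ => by rw [hf, mul_zero]
  have hgs : ∀ gs : List (VGen n d J), X (gs.map (lgen deg)).prod =
      ((gs.map (ghost deg)).sum : ℝ) • (gs.map (lgen deg)).prod := by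
    intro gs
    induction gs with
    | nil => rw [List.map_nil, List.prod_nil, hX.map_one]; simp
    | cons g gs ih =>
      rw [List.map_cons, List.prod_cons, hl, ih, hg, smul_mul_assoc, mul_smul_comm, ← add_smul,
        List.map_cons, List.sum_cons, Int.cast_add]
  unfold homogInt at hb
  induction hb using Submodule.span_induction with
  | mem x hx =>
    obtain ⟨f, μs, gs, rfl, rfl, rfl, rfl⟩ := hx
    rw [hl, hl, hf', hX.map_ldx_prod, hgs, zero_mul, mul_zero, add_zero, zero_mul, zero_add, mul_smul_comm]
  | zero => rw [map_zero, smul_zero]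
  | add x y _ _ h1 h2 => rw [map_add, h1, h2, smul_add]
  | smul c x _ h => rw [map_smul, h, smul_comm]

theorem isHorizontal_of_mem {p : ℕ} {r : ℤ} {b : LocAlg n d deg} (hb : b ∈ homogInt deg p 0 r) :
    IsHorizontal deg b := by
  classical
  intro k
  have hX := duDeriv_isVectorField deg k
  have hmul : ∀ a b, duDeriv deg k a = 0 → duDeriv deg k b = 0 → duDeriv deg k (a * b) = 0 := by
    intro a b ha hb
    rw [hX.leibniz, ha, hb, zero_mul, mul_zero, add_zero]
  have hlist : ∀ l : List (LocAlg n d deg), (∀ x ∈ l, duDeriv deg k x = 0) →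
      duDeriv deg k l.prod = 0 := by
    intro l hl
    induction l with
    | nil => exact hX.map_one
    | cons x l ih =>
      rw [List.prod_cons]
      exact hmul _ _ (hl x (by simp)) (ih fun y hy => hl y (by simp [hy]))
  unfold homogInt at hb
  induction hb using Submodule.span_induction with
  | mem x hx =>
    obtain ⟨f, μs, gs, rfl, h0, rfl, rfl⟩ := hx
    refine hmul _ _ (hmul _ _ (genDeriv_lfun deg _ f) (hlist _ ?_)) (hlist _ ?_)
    · intro x hx
      obtain ⟨μ, -, rfl⟩ := List.mem_map.mp hx
      exact hX.ldx μ
    · intro x hx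
      obtain ⟨g, hg, rfl⟩ := List.mem_map.mp hx
      have h0' : (gs.map vdeg).sum = 0 := by exact_mod_cast h0
      have hg0 : vdeg g = 0 := List.sum_eq_zero_iff.mp h0' _ (List.mem_map.mpr ⟨g, hg, rfl⟩)
      obtain l | l := g
      · exact (genDeriv_lgen deg _ _).trans (if_neg (by simp))
      · simp [vdeg] at hg0
  | zero => exact map_zero _
  | add x y _ _ h1 h2 => rw [map_add, h1, h2, add_zero]
  | smul c x _ h => rw [map_smul, h, smul_zero]

/-- Horizontal degree zero matters: the dx^μ anticommute with each other but are fixed by `lsign`,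
so they are not supercentral in general. -/
theorem isSupercentral_of_mem {r : ℤ} {b : LocAlg n d deg} (hb : b ∈ homogInt deg 0 0 r) :
    IsSupercentral deg r b := by
  have hgs : ∀ gs : List (VGen n d J), IsSupercentral deg
      ((gs.map vdeg).sum + (gs.map (ghost deg)).sum) (gs.map (lgen deg)).prod := by
    intro gs
    induction gs with
    | nil =>
      have := isSupercentral_lfun deg (1 : LocFun n d)
      rw [lfun_one] at this
      simpa using this
    | cons g gs ih =>
      have h1 : ((g :: gs).map vdeg).sum + ((g :: gs).map (ghost deg)).sum =
          par deg g + ((gs.map vdeg).sum + (gs.map (ghost deg)).sum) := by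
        simp only [List.map_cons, List.sum_cons, Nat.cast_add, par]
        ring
      rw [h1]
      exact (isSupercentral_lgen deg g).mul ih
  unfold homogInt at hb
  induction hb using Submodule.span_induction with
  | mem x hx =>
    obtain ⟨f, μs, gs, hμ, h0, rfl, rfl⟩ := hx
    rw [List.length_eq_zero_iff] at hμ
    subst hμ
    have := (isSupercentral_lfun deg f).mul (hgs gs)
    rw [h0, zero_add, zero_add] at this
    rwa [List.map_nil, List.prod_nil, mul_one]
  | zero => exact isSupercentral_zero _
  | add x y _ _ h1 h2 => exact h1.add h2
  | smul c x _ h => exact h.smul c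

theorem totalField_mem_homogInt (μ : Fin n) {p : ℕ} {q r : ℤ} {b : LocAlg n d deg}
    (hb : b ∈ homogInt deg p q r) : totalField deg μ b ∈ homogInt deg p q r := by
  have := (totalField_isVectorField deg μ).map_mem_homogInt (q' := 0) (r' := 0) ?_ ?_ ?_ hb
  · rwa [add_zero, add_zero] at this
  · intro ν
    rw [totalField_x]
    split_ifs
    · exact one_mem_homogInt
    · exact zero_mem _
  · intro k
    rw [totalField_lu, add_zero]
    exact lu_mem_homogInt (k.1, μ ::ₘ k.2)
  · intro k
    rw [totalField_ldu, add_zero, add_zero]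
    exact ldu_mem_homogInt (k.1, μ ::ₘ k.2)

theorem totalDerivs_mem_homogInt (I : MIdx n) {p : ℕ} {q r : ℤ} {b : LocAlg n d deg}
    (hb : b ∈ homogInt deg p q r) : totalDerivs deg I b ∈ homogInt deg p q r :=
  totalDerivs_induction deg (P := fun b => b ∈ homogInt deg p q r)
    (fun μ _ h => totalField_mem_homogInt μ h) hb I

theorem dhField_mem_homogInt {p : ℕ} {q r : ℤ} {b : LocAlg n d deg}
    (hb : b ∈ homogInt deg p q r) : dhField deg b ∈ homogInt deg (p + 1) q r := by
  rw [dhField_apply]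
  refine Submodule.sum_mem _ fun μ _ => ?_
  have := mul_mem_homogInt (ldx_mem_homogInt μ) (totalField_mem_homogInt μ hb)
  rwa [zero_add, zero_add, add_comm] at this

theorem dvField_mem_homogInt {p : ℕ} {q r : ℤ} {b : LocAlg n d deg}
    (hb : b ∈ homogInt deg p q r) : dvField deg b ∈ homogInt deg p (q + 1) r := by
  have := (dvField_isVectorField deg).map_mem_homogInt (q' := 1) (r' := 0) ?_ ?_ ?_ hb
  · rwa [add_zero] at this
  · intro ν
    rw [dvField_x]
    exact zero_mem _
  · intro k
    rw [dvField_lu, add_zero]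
    exact ldu_mem_homogInt k
  · intro k
    rw [dvField_ldu]
    exact zero_mem _

theorem iotaField_mem_homogInt {Ξ : Fin d ⊕ J → LocAlg n d deg}
    (hΞ : ∀ j, Ξ j ∈ homogInt deg 0 0 (ghostCoord deg j + 1)) {p : ℕ} {q r : ℤ}
    {b : LocAlg n d deg} (hb : b ∈ homogInt deg p q r) :
    iotaField deg Ξ b ∈ homogInt deg p (q - 1) (r + 1) := by
  refine (iotaField_isVectorField fun j => isSupercentral_of_mem (hΞ j)).map_mem_homogInt
    (q' := -1) (r' := 1) ?_ ?_ ?_ hb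
  · intro ν
    rw [iotaField_lfun]
    exact zero_mem _
  · intro k
    rw [iotaField_lu]
    exact zero_mem _
  · intro k
    rw [iotaField_ldu]
    exact totalDerivs_mem_homogInt k.2 (hΞ k.1)

/-- The vertical differential is injective on forms of vertical degree zero and nonzero ghost
number. -/
theorem eq_zero_of_dvField_eq_zero {p : ℕ} {r : ℤ} (hr : r ≠ 0) {b : LocAlg n d deg}
    (hb : b ∈ homogInt deg p 0 r) (h : dvField deg b = 0) : b = 0 := by
  -- Contraction with the Euler field ∑ gh(u_k) u_k ∂/∂u_k. It trades δu_k for u_k and so has parity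
  -- -1.
  let Z : LocAlg n d deg →ₗ[ℝ] LocAlg n d deg :=
    duField deg fun k => (ghostCoord deg k.1 : ℝ) • lu deg k
  have hZ : IsVectorField deg (-1) Z := duField_isVectorField fun k => by
    rw [neg_add_cancel, zero_add]
    exact (isSupercentral_lu deg k).smul _
  have hE := hZ.commutator (dvField_isVectorField deg)
  rw [neg_add_cancel] at hE
  have hE' : ∀ a, (Z ∘ₗ dvField deg - ((-1 : ℝ) ^ ((-1 : ℤ) * 1)) • (dvField deg ∘ₗ Z)) a
      = Z (dvField deg a) + dvField deg (Z a) := by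
    intro a
    change Z (dvField deg a) - ((-1 : ℝ) ^ ((-1 : ℤ) * 1)) • dvField deg (Z a) = _
    rw [mul_one, zpow_neg_one, inv_neg, inv_one, neg_one_smul, sub_neg_eq_add]
  -- A Cartan formula: Z d_v + d_v Z is the Lie derivative along the Euler field, which multiplies
  -- by the ghost number. On b both terms vanish, the first by hypothesis and the second because b
  -- has no δu, so r b = 0.
  have hb' := hE.eq_ghost_smul ?_ ?_ hb
  · rw [hE', h, map_zero, zero_add] at hb'
    have hZb : Z b = 0 := by
      change duField deg _ b = 0
      simp only [duField_apply, isHorizontal_of_mem hb _, mul_zero, finsum_zero]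
    rw [hZb, map_zero] at hb'
    have h2 := congrArg (fun x => ((r : ℝ)⁻¹) • x) hb'
    simp only [smul_zero, smul_smul] at h2
    rw [inv_mul_cancel₀ (by exact_mod_cast hr), one_smul] at h2
    exact h2.symm
  · intro a
    rw [hE', show Z (lfun deg (coordFun a)) = 0 from duField_lfun _ _, map_zero, add_zero]
    obtain μ | ⟨a, I⟩ := a
    · rw [dvField_x, map_zero]
    · rw [show dvField deg (lfun deg (coordFun (Sum.inr (a, I)))) = _ from
        dvField_lu deg (Sum.inl a, I)]
      refine (duField_ldu _ _).trans ?_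
      simp [ghostCoord]
  · intro g
    rw [hE']
    obtain ⟨j, I⟩ | k := g
    · rw [show Z (lgen deg (Sum.inl (j, I))) = 0 from duField_lu _ (Sum.inr j, I),
        show dvField deg (lgen deg (Sum.inl (j, I))) = _ from dvField_lu deg (Sum.inr j, I),
        map_zero, add_zero]
      exact duField_ldu _ _
    · rw [show Z (lgen deg (Sum.inr k)) = _ from duField_ldu _ k,
        show dvField deg (lgen deg (Sum.inr k)) = 0 from dvField_ldu deg k, map_zero, zero_add,
        map_smul, dvField_lu]
      rfl

end Chart

/-! ### The descent computation -/

section Chart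

variable {n d : ℕ} {J : Type} {deg : J → ℤ}

/-- The descent argument in one chart. -/
theorem lieField_eq_dhField {Q : Fin d ⊕ J → LocAlg n d deg}
    (hQ : ∀ j, Q j ∈ homogInt deg 0 0 (ghostCoord deg j + 1))
    (hsq : ∀ j, lieField deg Q (Q j) = 0) {p : ℕ} {r : ℤ} (hr : r + 1 ≠ 0)
    {L L' γ' γ'' η η' : LocAlg n d deg}
    (hL : L ∈ homogInt deg p 0 r)
    (hcmr : dhField deg ((2 : ℝ) • L' - iotaField deg Q γ') ∈ homogInt deg p 0 (r + 1))
    (hη : dvField deg η = 0)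
    (hlie : lieField deg Q η = - dhField deg η')
    (h : iotaField deg Q η = dvField deg L + dhField deg γ')
    (h' : iotaField deg Q η' = dvField deg L' + dhField deg γ'') :
    lieField deg Q L = dhField deg ((2 : ℝ) • L' - iotaField deg Q γ') := by
  have hQ' := fun j => isSupercentral_of_mem (hQ j)
  have hcomm := iotaField_lieField deg hQ'
    (fun j I => isHorizontal_of_mem (totalDerivs_mem_homogInt I (hQ j))) hsq
  have hιL : iotaField deg Q L = 0 := (isHorizontal_of_mem hL).iotaField Q
  have hlieL : lieField deg Q L = iotaField deg Q (dvField deg L) := by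
    rw [lieField_apply, hιL, map_zero, sub_zero]
  -- Closedness of η gives Lie_Q η = -d_v ι η = -d_v d_h γ'. Thus η' and d_v γ' agree under d_h,
  -- without assuming η' = d_v γ'.
  have h1 : dhField deg (dvField deg γ') = dhField deg η' := by
    have h2 := hlie
    rw [lieField_apply, hη, map_zero, zero_sub, neg_inj, h, map_add, dvField_dvField,
      zero_add] at h2
    rw [dhField_dvField, h2]
  have h3 : dhField deg (iotaField deg Q (dvField deg γ')) = dhField deg (dvField deg L') := by
    rw [dhField_iotaField deg hQ', h1, ← dhField_iotaField deg hQ', h', map_add, dhField_dhField,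
      add_zero]
  -- First evaluation of Lie_Q ι η, by commuting; the term with γ'' drops out because d_h² = 0.
  have h4 : lieField deg Q (iotaField deg Q η) = - dhField deg (dvField deg L') := by
    rw [← hcomm, hlie, map_neg, ← dhField_iotaField deg hQ', h', map_add, dhField_dhField, add_zero]
  -- Second evaluation, by expanding ι η. One copy of d_h d_v L' comes from `h3` and one from `h4`,
  -- which explains the factor 2 in the modified Lagrangian.
  have h5 : dvField deg (iotaField deg Q (dvField deg L)) =
      dhField deg (dvField deg L') + dhField deg (dvField deg L')
        - dhField deg (dvField deg (iotaField deg Q γ')) := by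
    rw [h, map_add, lieField_apply, lieField_apply, dvField_dvField, map_zero, zero_sub,
      ← dhField_dvField, ← dhField_iotaField deg hQ', ← dhField_iotaField deg hQ', h3,
      ← dhField_dvField] at h4
    rw [← sub_eq_zero] at h4 ⊢
    rw [← neg_eq_zero, ← h4]
    abel
  rw [← sub_eq_zero]
  -- Both sides have vertical degree 0 and ghost number r + 1 ≠ 0, so it suffices to compare their
  -- vertical differentials.
  refine eq_zero_of_dvField_eq_zero hr (p := p) (sub_mem ?_ hcmr) ?_
  · rw [hlieL]
    have := iotaField_mem_homogInt hQ (dvField_mem_homogInt hL)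
    rwa [zero_add, sub_self] at this
  · rw [map_sub, hlieL, h5, ← dhField_dvField, map_sub, map_sub, map_smul, map_smul, two_smul,
      sub_self]

end Chart

/-! ### Lie derivatives of the Lagrangians of an extended theory -/

section Global

variable {n : ℕ} {M : Type u} [TopologicalSpace M] [ChartedSpace (EuclideanSpace ℝ (Fin n)) M]
  {Y : GradedBundle.{u, v, w} n M}

theorem VField.comp_mem_homogInt {k : ℤ} (Ξ : VField Y k) (c : Y.Chart) (j : Y.Idx) :
    Ξ.comp c j ∈ homogInt Y.degJ 0 0 (ghostCoord Y.degJ j + k) := by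
  have := Ξ.comp_mem c j
  rwa [homog_eq_homogInt] at this

theorem OmegaLoc.mem_homogInt {p q : ℕ} {r : ℤ} {θ : Y.Form} (hθ : θ ∈ OmegaLoc Y p q r)
    (c : Y.Chart) : θ c ∈ homogInt Y.degJ p q r := by
  have := hθ.2 c
  rwa [homog_eq_homogInt] at this

namespace ExtendedBVBFV

variable {m : ℕ} (T : ExtendedBVBFV Y m)

theorem dvField_Ω (p : ℕ) (c : Y.Chart) : dvField Y.degJ (T.Ω p c) = 0 := by
  by_cases hp : p ≤ m
  · rw [T.potential p hp]
    exact dvField_dvField Y.degJ _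
  · rw [T.Ω_eq_zero p (not_le.mp hp)]
    exact map_zero _

theorem lieField_Ω {p : ℕ} (hp : p ≤ n) (c : Y.Chart) :
    lieField Y.degJ (T.Q.comp c) (T.Ω p c) = - dhField Y.degJ (T.Ω (p + 1) c) := by
  obtain hp | rfl := hp.lt_or_eq
  · have h := congrFun (T.ascendant.2.1 p hp) c
    -- In `IsAscendant` the sign is (-1)^(q + r) with q = 2 and r = -1, that is, -1.
    have h2 : lieField Y.degJ (T.Q.comp c) (T.Ω p c)
        = ((-1 : ℝ) ^ (((2 : ℕ) : ℤ) + (-1))) • dhField Y.degJ (T.Ω (p + 1) c) := by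
      rw [← lieLoc_eq, ← dhLoc_eq]
      exact h
    rw [h2]
    norm_num
  · have h := congrFun T.ascendant.2.2 c
    rw [← lieLoc_eq, T.Ω_beyond _ (Nat.lt_succ_self _)]
    refine h.trans ?_
    rw [Pi.zero_apply, map_zero, neg_zero]

theorem iotaField_Ω {p : ℕ} (hp : p ≤ n) (c : Y.Chart) :
    iotaField Y.degJ (T.Q.comp c) (T.Ω p c)
      = dvField Y.degJ (T.L p c) + dhField Y.degJ (T.γ (p + 1) c) := by
  obtain hp | rfl := hp.lt_or_eq
  · have h := congrFun (T.descent p hp) c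
    rw [← dhLoc_eq]
    exact h
  · have h := congrFun T.descent_top c
    rw [T.γ_beyond _ (Nat.lt_succ_self _), Pi.zero_apply, map_zero, add_zero]
    exact h

theorem lie_L {p : ℕ} (hp : p ≤ n) : lie T.Q (T.L p) = dh (T.LCMR (p + 1)) := by
  funext c
  have hQ := T.Q.comp_mem_homogInt c
  have hsq : ∀ j, lieField Y.degJ (T.Q.comp c) (T.Q.comp c j) = 0 := by
    intro j
    rw [← lieLoc_eq]
    exact T.cohomological c j
  -- For p < n, d_h restores the degree lost in passing to p + 1. For p = n the truncated n - (p +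
  -- 1) would give the wrong degree, but the form is zero by convention.
  have hcmr : dhField Y.degJ ((2 : ℝ) • T.L (p + 1) c
      - iotaField Y.degJ (T.Q.comp c) (T.γ (p + 1) c)) ∈ homogInt Y.degJ (n - p) 0 ((p : ℤ) + 1) := by
    by_cases hp' : p + 1 ≤ n
    · have h1 := OmegaLoc.mem_homogInt (T.L_mem _ hp') c
      have h2 := iotaField_mem_homogInt hQ (OmegaLoc.mem_homogInt (T.γ_mem _ hp') c)
      have h3 := mem_homogInt_congr h2 (r' := ((p + 1 : ℕ) : ℤ)) rfl (sub_self _) (by ring)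
      exact mem_homogInt_congr (dhField_mem_homogInt (sub_mem (Submodule.smul_mem _ 2 h1) h3))
        (by omega) rfl (by push_cast; rfl)
    · have hp' : n < p + 1 := not_le.mp hp'
      rw [T.L_beyond _ hp', T.γ_beyond _ hp', Pi.zero_apply, map_zero, smul_zero, sub_zero,
        map_zero]
      exact zero_mem _
  have h' : ∃ γ'', iotaField Y.degJ (T.Q.comp c) (T.Ω (p + 1) c)
      = dvField Y.degJ (T.L (p + 1) c) + dhField Y.degJ γ'' := by
    by_cases hp' : p + 1 ≤ n
    · exact ⟨_, T.iotaField_Ω hp' c⟩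
    · have hp' : n < p + 1 := not_le.mp hp'
      refine ⟨0, ?_⟩
      rw [T.L_beyond _ hp', T.Ω_beyond _ hp', Pi.zero_apply, map_zero, map_zero, map_zero, add_zero]
  obtain ⟨γ'', h'⟩ := h'
  -- The ghost number p + 1 of Lie_Q 𝓛^(p) is positive, also for p = 0.
  have := lieField_eq_dhField hQ hsq (p := n - p) (r := p) (by positivity)
    (OmegaLoc.mem_homogInt (T.L_mem p hp) c) hcmr (T.dvField_Ω p c) (T.lieField_Ω hp c)
    (T.iotaField_Ω hp c) h'
  rw [← lieLoc_eq, ← dhLoc_eq] at this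
  exact this

end ExtendedBVBFV

end Global

/-! ### Functions of finitely many jet coordinates -/

section FiniteDependence

variable {n d : ℕ}

/-- A function on the infinite jet space that depends on finitely many coordinates only. -/
def FinitelyDetermined {β : Type*} (F : Jet n d → β) : Prop :=
  ∃ S : Finset (Coord n d), DependsOn F (S : Set (Coord n d))

theorem FinitelyDetermined.coord (a : Coord n d) : FinitelyDetermined fun z : Jet n d => z a :=
  ⟨{a}, fun _ _ h => h a (by simp)⟩

theorem FinitelyDetermined.const {β : Type*} (b : β) :
    FinitelyDetermined fun _ : Jet n d => b := ⟨∅, fun _ _ _ => rfl⟩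

theorem FinitelyDetermined.comp {β β' : Type*} {F : Jet n d → β} (hF : FinitelyDetermined F)
    (H : β → β') : FinitelyDetermined fun z => H (F z) := by
  obtain ⟨S, hS⟩ := hF
  exact ⟨S, fun x y h => congrArg H (hS h)⟩

theorem FinitelyDetermined.pi {ι : Type*} [Finite ι] {β : ι → Type*} {F : ∀ i, Jet n d → β i}
    (hF : ∀ i, FinitelyDetermined (F i)) : FinitelyDetermined fun z i => F i z := by
  classical
  have := Fintype.ofFinite ι
  choose S hS using hF
  refine ⟨Finset.univ.biUnion S, fun x y h => funext fun i => hS i fun a ha => h a ?_⟩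
  simp only [Finset.coe_biUnion, Finset.coe_univ, Set.mem_univ, Set.iUnion_true, Set.mem_iUnion]
  exact ⟨i, ha⟩

theorem FinitelyDetermined.prodMk {β β' : Type*} {F : Jet n d → β} {G : Jet n d → β'}
    (hF : FinitelyDetermined F) (hG : FinitelyDetermined G) :
    FinitelyDetermined fun z => (F z, G z) := by
  classical
  obtain ⟨S, hS⟩ := hF
  obtain ⟨T, hT⟩ := hG
  refine ⟨S ∪ T, fun x y h => Prod.ext (hS fun a ha => h a ?_) (hT fun a ha => h a ?_)⟩
  · simp [Finset.mem_coe.mp ha]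
  · simp [Finset.mem_coe.mp ha]

theorem FinitelyDetermined.add {F G : Jet n d → ℝ} (hF : FinitelyDetermined F)
    (hG : FinitelyDetermined G) : FinitelyDetermined fun z => F z + G z :=
  (hF.prodMk hG).comp fun p => p.1 + p.2

theorem FinitelyDetermined.mul {F G : Jet n d → ℝ} (hF : FinitelyDetermined F)
    (hG : FinitelyDetermined G) : FinitelyDetermined fun z => F z * G z :=
  (hF.prodMk hG).comp fun p => p.1 * p.2

theorem FinitelyDetermined.sum {ι : Type*} [Fintype ι] {F : ι → Jet n d → ℝ}
    (hF : ∀ i, FinitelyDetermined (F i)) : FinitelyDetermined fun z => ∑ i, F i z :=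
  (FinitelyDetermined.pi hF).comp fun p => ∑ i, p i

theorem pderivRaw_eq_zero {F : Jet n d → ℝ} {S : Set (Coord n d)} (hF : DependsOn F S)
    {a : Coord n d} (ha : a ∉ S) (z : Jet n d) : pderivRaw a F z = 0 := by
  have : (fun t => F (Function.update z a t)) = fun _ => F z := by
    funext t
    refine hF fun b hb => ?_
    rw [Function.update_of_ne]
    rintro rfl
    exact ha hb
  rw [pderivRaw, this, deriv_const]

theorem dependsOn_pderivRaw {F : Jet n d → ℝ} {S : Set (Coord n d)} (hF : DependsOn F S)
    (a : Coord n d) : DependsOn (pderivRaw a F) S := by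
  intro x y h
  by_cases ha : a ∈ S
  · have : (fun t => F (Function.update x a t)) = fun t => F (Function.update y a t) := by
      funext t
      refine hF fun b hb => ?_
      by_cases hab : b = a
      · subst hab
        simp
      · rw [Function.update_of_ne hab, Function.update_of_ne hab]
        exact h b hb
    rw [pderivRaw, pderivRaw, this, h a ha]
  · rw [pderivRaw_eq_zero hF ha, pderivRaw_eq_zero hF ha]

/-- This makes the sums in `newTangent` finite, so that linear maps can be moved through them. -/
theorem FinitelyDetermined.finite_support_pderivRaw {F : Jet n d → ℝ} (hF : FinitelyDetermined F)
    (z : Jet n d) : (Function.support fun k => pderivRaw (Sum.inr k) F z).Finite := by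
  obtain ⟨S, hS⟩ := hF
  refine (S.finite_toSet.preimage (f := Sum.inr) Sum.inr_injective.injOn).subset fun k hk => ?_
  by_contra h
  exact hk (pderivRaw_eq_zero hS h z)

end FiniteDependence

/-! ### Finiteness of the transition formulas for jets -/

section Global

variable {n : ℕ} {M : Type u} [TopologicalSpace M] [ChartedSpace (EuclideanSpace ℝ (Fin n)) M]
  {Y : GradedBundle.{u, v, w} n M}

theorem FinitelyDetermined.totalRaw {F : Y.Jets → ℝ} (hF : FinitelyDetermined F) (ν : Fin n) :
    FinitelyDetermined (totalRaw ν F) := by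
  classical
  obtain ⟨S, hS⟩ := hF
  -- Besides S, the total derivative involves only the coordinates u_{I ∪ ν} that multiply a
  -- possibly nonzero ∂F/∂u_I, that is, those with u_I in S.
  refine ⟨S ∪ S.image (Sum.elim Sum.inl fun k => Sum.inr (k.1, ν ::ₘ k.2)), fun x y h => ?_⟩
  have hS' : ∀ a ∈ (S : Set (Coord n Y.d)), x a = y a := fun a ha =>
    h a (Finset.mem_coe.mpr (Finset.mem_union_left _ ha))
  unfold BVBFV.totalRaw
  rw [dependsOn_pderivRaw hS _ hS']
  congr 1
  refine finsum_congr fun k => ?_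
  by_cases hk : Sum.inr k ∈ S
  · rw [dependsOn_pderivRaw hS _ hS', h (Sum.inr (k.1, ν ::ₘ k.2))]
    exact Finset.mem_coe.mpr (Finset.mem_union_right _ (Finset.mem_image.mpr ⟨_, hk, rfl⟩))
  · rw [pderivRaw_eq_zero hS hk, pderivRaw_eq_zero hS hk, mul_zero, mul_zero]

variable (c c' : Y.Chart)

theorem finitelyDetermined_pt : FinitelyDetermined (Chart.pt c) :=
  ((FinitelyDetermined.pi fun μ => FinitelyDetermined.coord (Sum.inl μ)).prodMk
    (FinitelyDetermined.pi fun a => FinitelyDetermined.coord (Sum.inr (a, 0)))).comp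
    fun p => c.total.symm (WithLp.toLp 2 p.1, WithLp.toLp 2 p.2)

theorem finitelyDetermined_jac (ν μ : Fin n) :
    FinitelyDetermined fun z => jac c' c (newBase c c' z) ν μ :=
  (finitelyDetermined_pt c).comp fun y => jac c' c (c'.total y).1 ν μ

theorem finitelyDetermined_newU (a : Fin Y.d) (l : List (Fin n)) :
    FinitelyDetermined (newU c c' a l) := by
  induction l with
  | nil => exact (finitelyDetermined_pt c).comp fun y => (c'.total y).2 a
  | cons μ l ih =>
    exact FinitelyDetermined.sum fun ν => (finitelyDetermined_jac c c' ν μ).mul (ih.totalRaw ν)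

theorem finitelyDetermined_newC (i : Y.Part) (j : Fin (Y.rk i)) (l : List (Fin n))
    (k : Fin (Y.rk i) × MIdx n) : FinitelyDetermined (newC c c' i j l k) := by
  induction l generalizing k with
  | nil =>
    exact (finitelyDetermined_pt c).comp fun y =>
      if k.2 = 0 then transMat c c' i j k.1 y else 0
  | cons μ l ih =>
    refine FinitelyDetermined.sum fun ν => (finitelyDetermined_jac c c' ν μ).mul
      (((ih k).totalRaw ν).add ?_)
    by_cases h : ν ∈ k.2
    · simp only [h, if_true]
      exact ih _
    · simp only [h, if_false]
      exact FinitelyDetermined.const 0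

theorem totalRaw_zero (ν : Fin n) : totalRaw (Y := Y) ν 0 = 0 := by
  have h : ∀ (a : Coord n Y.d) (z : Y.Jets), pderivRaw a 0 z = 0 := by
    intro a z
    simp [pderivRaw]
  funext z
  simp only [totalRaw, h, mul_zero, finsum_zero, add_zero, Pi.zero_apply]

/-- Initially only the empty multi-index occurs, and each total derivative adds to the support at
most the indices obtained by adjoining one ν, of which there are n. -/
theorem finite_support_newC (i : Y.Part) (j : Fin (Y.rk i)) (l : List (Fin n)) :
    (Function.support (newC c c' i j l)).Finite := by
  induction l with
  | nil =>
    refine (Set.finite_range fun k : Fin (Y.rk i) => (k, (0 : MIdx n))).subset ?_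
    rintro ⟨k, K⟩ hk
    by_contra h
    refine hk ?_
    have hK : K ≠ 0 := by
      rintro rfl
      exact h ⟨k, rfl⟩
    funext z
    simp only [newC, hK, if_false, Pi.zero_apply]
  | cons μ l ih =>
    refine (ih.union (Set.finite_iUnion fun ν : Fin n =>
      ih.image fun k => (k.1, ν ::ₘ k.2))).subset ?_
    rintro k hk
    by_contra h
    simp only [Set.mem_union, Set.mem_iUnion, not_or, not_exists] at h
    have h1 : newC c c' i j l k = 0 := by
      by_contra h'
      exact h.1 h'
    refine hk ?_
    funext z
    refine Finset.sum_eq_zero fun ν _ => ?_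
    rw [h1, totalRaw_zero, Pi.zero_apply, zero_add]
    split_ifs with hν
    · have h2 : newC c c' i j l (k.1, k.2.erase ν) = 0 := by
        by_contra h'
        exact h.2 ν ⟨_, h', Prod.ext rfl (Multiset.cons_erase hν)⟩
      rw [h2, Pi.zero_apply, mul_zero]
    · rw [mul_zero]

/-- A linear map commutes with the formation of tangent vectors if it is linear over the coordinates
of nonzero ghost number. -/
theorem map_newTangent (φ : Y.Val →ₗ[ℝ] Y.Val) (z : Y.Jets) (v : Y.Idx × MIdx n → Y.Val)
    (hφ : ∀ l k, φ (v l * fgen Y.degJ (Sum.inl k)) = φ (v l) * fgen Y.degJ (Sum.inl k))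
    (l : Y.Idx × MIdx n) :
    φ (newTangent c c' z v l) = newTangent c c' z (fun l => φ (v l)) l := by
  -- A `∑ᶠ` of infinite support is zero by default, so φ may be moved inside only once the
  -- coefficients are known to have finite support.
  have hsupp : ∀ {K : Type} {r : K → ℝ} (x : K → Y.Val), (Function.support r).Finite →
      (Function.support fun k => r k • x k).Finite := by
    intro K r x hr
    refine hr.subset fun k hk h => hk ?_
    change r k • x k = 0
    rw [h, zero_smul]
  have hmap : ∀ {K : Type} {r : K → ℝ} (x : K → Y.Val), (Function.support r).Finite →
      φ (∑ᶠ k, r k • x k) = ∑ᶠ k, r k • φ (x k) := by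
    intro K r x hr
    rw [map_finsum φ (hsupp x hr)]
    exact finsum_congr fun k => map_smul φ _ _
  obtain ⟨a | j, I⟩ := l
  · exact hmap _ ((finitelyDetermined_newU c c' a I.sort).finite_support_pderivRaw z)
  · have hC := finite_support_newC c c' j.1 j.2 I.sort
    have hC' : (Function.support fun k => newC c c' j.1 j.2 I.sort k z).Finite :=
      hC.subset fun k hk h => hk (congrFun h z)
    have hD := fun k => (finitelyDetermined_newC c c' j.1 j.2 I.sort k).finite_support_pderivRaw z
    simp only [newTangent]
    rw [map_add, hmap _ hC']
    congr 1
    rw [map_finsum φ]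
    · refine finsum_congr fun k => ?_
      rw [hmap _ (hD k)]
      exact finsum_congr fun l => by rw [hφ]
    · refine hC.subset fun k hk h => hk ?_
      have h0 : ∀ l, pderivRaw (Sum.inr l) (newC c c' j.1 j.2 I.sort k) z = 0 := by
        intro l
        rw [show newC c c' j.1 j.2 _ k = 0 from h]
        simp [pderivRaw]
      simp only [h0, zero_smul, finsum_zero]

end Global

/-! ### Contraction at a point of the jet space -/

section Evaluation

variable {n d : ℕ} {J : Type} (deg : J → ℤ) (z : Jet n d)

theorem evalAt_constHom (x : FormAlg n d deg) : evalAt deg z (constHom deg x) = x := by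
  change (1 : ℝ) • x = x
  exact one_smul ℝ x

theorem evalAt_lfun (f : LocFun n d) :
    evalAt deg z (lfun deg f) = algebraMap ℝ (FormAlg n d deg) (f.1 z) := by
  change f.1 z • (1 : FormAlg n d deg) = _
  exact (Algebra.algebraMap_eq_smul_one _).symm

/-- The contraction with a vertical local vector field at a point of the infinite jet space. -/
def iotaAt (Ξ : Fin d ⊕ J → LocAlg n d deg) : FormAlg n d deg →ₗ[ℝ] FormAlg n d deg where
  toFun x := evalAt deg z (iotaField deg Ξ (constHom deg x))
  map_add' x y := by rw [map_add, map_add, map_add]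
  map_smul' r x := by rw [map_smul, map_smul, map_smul, RingHom.id_apply]

theorem iotaAt_apply (Ξ : Fin d ⊕ J → LocAlg n d deg) (x : FormAlg n d deg) :
    iotaAt deg z Ξ x = evalAt deg z (iotaField deg Ξ (constHom deg x)) := rfl

theorem iotaAt_fgen_inl (Ξ : Fin d ⊕ J → LocAlg n d deg) (k : J × MIdx n) :
    iotaAt deg z Ξ (fgen deg (Sum.inl k)) = 0 := by
  rw [iotaAt_apply]
  have : iotaField deg Ξ (constHom deg (fgen deg (Sum.inl k))) = 0 :=
    iotaField_lu deg (Sum.inr k.1, k.2)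
  rw [this, map_zero]

theorem iotaAt_fgen_inr (Ξ : Fin d ⊕ J → LocAlg n d deg) (k : (Fin d ⊕ J) × MIdx n) :
    iotaAt deg z Ξ (fgen deg (Sum.inr k)) = evalAt deg z (totalDerivs deg k.2 (Ξ k.1)) :=
  congrArg (evalAt deg z) (iotaField_ldu deg k)

section

variable {Ξ : Fin d ⊕ J → LocAlg n d deg}
  (hΞ : ∀ j, IsSupercentral deg (ghostCoord deg j + 1) (Ξ j))
include hΞ

theorem iotaAt_fdx (μ : Fin n) : iotaAt deg z Ξ (fdx deg μ) = 0 := by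
  rw [iotaAt_apply]
  have : iotaField deg Ξ (constHom deg (fdx deg μ)) = 0 := (iotaField_isVectorField hΞ).ldx μ
  rw [this, map_zero]

theorem iotaAt_mul (x y : FormAlg n d deg) :
    iotaAt deg z Ξ (x * y) = iotaAt deg z Ξ x * y + x * iotaAt deg z Ξ y := by
  rw [iotaAt_apply, map_mul, (iotaField_isVectorField hΞ).leibniz, lsign_even deg Even.zero,
    map_add, map_mul, map_mul, evalAt_constHom, evalAt_constHom]
  rfl

theorem iotaAt_algebraMap (r : ℝ) : iotaAt deg z Ξ (algebraMap ℝ _ r) = 0 := by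
  rw [Algebra.algebraMap_eq_smul_one, map_smul, iotaAt_apply, map_one,
    (iotaField_isVectorField hΞ).map_one, map_zero, smul_zero]

/-- Contraction is linear over functions and never differentiates a coefficient, so its value at z
depends only on the value of the form at z. -/
theorem evalAt_iotaField (b : LocAlg n d deg) :
    evalAt deg z (iotaField deg Ξ b) = iotaAt deg z Ξ (evalAt deg z b) := by
  refine LocAlg.induction deg
    (P := fun b => evalAt deg z (iotaField deg Ξ b) = iotaAt deg z Ξ (evalAt deg z b))
    ?_ ?_ ?_ ?_ ?_ b
  · intro f
    rw [iotaField_lfun, map_zero, evalAt_lfun, iotaAt_algebraMap deg z hΞ]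
  · intro μ
    change _ = iotaAt deg z Ξ (evalAt deg z (constHom deg (fdx deg μ)))
    rw [evalAt_constHom]
    rfl
  · intro g
    change _ = iotaAt deg z Ξ (evalAt deg z (constHom deg (fgen deg g)))
    rw [evalAt_constHom]
    rfl
  · intro a b ha hb
    rw [map_add, map_add, map_add, map_add, ha, hb]
  · intro a b ha hb
    rw [(iotaField_isVectorField hΞ).leibniz, lsign_even deg Even.zero, map_add, map_mul, map_mul,
      map_mul, iotaAt_mul deg z hΞ, ha, hb]

end

end Evaluation

/-! ### Contraction preserves compatibility under changes of charts -/

section LocalForms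

variable {n : ℕ} {M : Type u} [TopologicalSpace M] [ChartedSpace (EuclideanSpace ℝ (Fin n)) M]
  {Y : GradedBundle.{u, v, w} n M}

/-- On pairs of values the two contractions form an untwisted derivation, so the graph is preserved
as soon as its generators are mapped into it. The pairs for dx' and u' go to zero, and the pair for
δu' goes to the pair of components of Q, covered by `VField.compat`. -/
theorem iotaAt_mem_transGraph (Q : VField Y 1) {c c' : Y.Chart} {z : Y.Jets} (h : Overlap c c' z)
    {x : Y.Val × Y.Val} (hx : x ∈ transGraph c c' z) :
    (iotaAt Y.degJ (newJet c c' z) (Q.comp c') x.1, iotaAt Y.degJ z (Q.comp c) x.2)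
      ∈ transGraph c c' z := by
  have hQ := fun (c : Y.Chart) j => isSupercentral_of_mem (Q.comp_mem_homogInt c j)
  have hx0 := hx
  unfold transGraph at hx0
  clear hx
  induction hx0 using Algebra.adjoin_induction with
  | mem x hx' =>
    rcases hx' with (⟨μ, rfl⟩ | ⟨j, I, rfl⟩) | ⟨k, rfl⟩
    · simp only [map_sum, map_smul, iotaAt_fdx _ _ (hQ _), smul_zero, Finset.sum_const_zero]
      exact zero_mem _
    · have h0 : iotaAt Y.degJ z (Q.comp c) (newGen c c' z j I) = 0 := by
        refine finsum_induction (fun x => iotaAt Y.degJ z (Q.comp c) x = 0) (map_zero _) ?_ ?_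
        · intro x y hx hy
          rw [map_add, hx, hy, add_zero]
        · intro k
          rw [map_smul, iotaAt_fgen_inl, smul_zero]
      rw [iotaAt_fgen_inl, h0]
      exact zero_mem _
    · simp only
      -- The formula for δu' is linear in δu with coefficients killed by ι, so contracting it
      -- replaces each δu by the corresponding component of Q.
      rw [map_newTangent]
      · simp only [iotaAt_fgen_inr]
        exact Q.compat c c' z h k
      · intro l k
        rw [iotaAt_mul _ _ (hQ c), iotaAt_fgen_inl, mul_zero, add_zero]
  | algebraMap r =>
    have : (algebraMap ℝ (Y.Val × Y.Val) r) = (algebraMap ℝ Y.Val r, algebraMap ℝ Y.Val r) := rfl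
    rw [this, iotaAt_algebraMap _ _ (hQ _), iotaAt_algebraMap _ _ (hQ _)]
    exact zero_mem _
  | add x y hx hy h1 h2 =>
    have := add_mem h1 h2
    rw [Prod.fst_add, Prod.snd_add, map_add, map_add]
    exact this
  | mul x y hx hy h1 h2 =>
    have hx' : x ∈ transGraph c c' z := hx
    have hy' : y ∈ transGraph c c' z := hy
    have := add_mem (mul_mem h1 hy') (mul_mem hx' h2)
    rw [Prod.fst_mul, Prod.snd_mul, iotaAt_mul _ _ (hQ _), iotaAt_mul _ _ (hQ _)]
    exact this

theorem IsLocalForm.iota {θ : Y.Form} (hθ : IsLocalForm θ) (Q : VField Y 1) :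
    IsLocalForm (iota Q θ) := by
  intro c c' z h
  have hQ := fun (c : Y.Chart) j => isSupercentral_of_mem (Q.comp_mem_homogInt c j)
  have := iotaAt_mem_transGraph Q h (hθ c c' z h)
  rw [← evalAt_iotaField _ _ (hQ _), ← evalAt_iotaField _ _ (hQ _)] at this
  exact this

theorem IsLocalForm.zero : IsLocalForm (0 : Y.Form) := by
  intro c c' z _
  rw [Pi.zero_apply, Pi.zero_apply, map_zero, map_zero]
  exact zero_mem _

theorem IsLocalForm.smul {θ : Y.Form} (hθ : IsLocalForm θ) (r : ℝ) : IsLocalForm (r • θ) := by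
  intro c c' z h
  have := Subalgebra.smul_mem _ (hθ c c' z h) r
  rw [Pi.smul_apply, Pi.smul_apply, map_smul, map_smul]
  exact this

theorem IsLocalForm.sub {θ η : Y.Form} (hθ : IsLocalForm θ) (hη : IsLocalForm η) :
    IsLocalForm (θ - η) := by
  intro c c' z h
  have := sub_mem (hθ c c' z h) (hη c c' z h)
  rw [Pi.sub_apply, Pi.sub_apply, map_sub, map_sub]
  exact this

theorem ExtendedBVBFV.isLocalForm_LCMR {m : ℕ} (T : ExtendedBVBFV Y m) (p : ℕ) :
    IsLocalForm (T.LCMR p) := by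
  have hL : IsLocalForm (T.L p) := by
    by_cases hp : p ≤ n
    · exact (T.L_mem p hp).1
    · rw [T.L_beyond p (not_le.mp hp)]
      exact IsLocalForm.zero
  have hγ : IsLocalForm (T.γ p) := by
    by_cases hp : p ≤ n
    · exact (T.γ_mem p hp).1
    · rw [T.γ_beyond p (not_le.mp hp)]
      exact IsLocalForm.zero
  exact (hL.smul 2).sub (hγ.iota T.Q)

end LocalForms

end

end BVBFV

theorem mainTheorem8 {n : ℕ} {M : Type u} [TopologicalSpace M]
    [ChartedSpace (EuclideanSpace ℝ (Fin n)) M] [IsManifold (𝓡 n) ∞ M]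
    (Y : BVBFV.GradedBundle.{u, v, w} n M) (m : ℕ) (T : BVBFV.ExtendedBVBFV Y m)
    (p : ℕ) (hp : p ≤ n) :
    BVBFV.lie T.Q (T.L p) = BVBFV.dh (T.LCMR (p + 1)) ∧
      BVBFV.IsNoetherSymmetry T.Q (T.L p) := by
  -- The modified Lagrangian itself is the required d_h-primitive.
  refine ⟨T.lie_L hp, T.LCMR (p + 1), T.isLocalForm_LCMR (p + 1), ?_⟩
  rw [sub_zero]
  exact T.lie_L hp
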